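/- **Theorem.** Fix a free ultrafilter $\mathcal U$ on $\mathbb N$. Let $G$ be a countable, discrete, amenable group, let $A$ be a separable, unital $C^*$-algebra whose set $T(A)$ of tracial states is non-empty, and let $\alpha\colon G\to\mathrm{Aut}(A)$ be an action. If $A$ is uniformly McDuff and $\alpha$ has the weak Rokhlin property with respect to invariant traces, then $(A,\alpha)$ has the McDuff property with respect to invariant traces. The notions are the following. Let $T(A)^\alpha$ be the set of $\alpha$-invariant tracial states. For $\tau\in T(A)$ put $\|a\|_{2,\tau}=\tau(a^*a)^{1/2}$, and for $T\subseteq T(A)$ put $\|a\|_{2,T}=\sup_{\tau\in T}\|a\|_{2,\tau}$. Let $$A_{\mathcal U}=\ell^\infty(A)/\{(a_n):\lim_{n\to\mathcal U}\|a_n\|=0\},\qquad J_T=\{[(a_n)]\in A_{\mathcal U}:\lim_{n\to\mathcal U}\|a_n\|_{2,T}=0\},\qquad A^{\mathcal U}=A_{\mathcal U}/J_{T(A)},$$ with the coordinatewise actions $\alpha_{\mathcal U}$ on $A_{\mathcal U}$ and $\alpha^{\mathcal U}$ on $A^{\mathcal U}$. Let $A_{\mathcal U}\cap A'$ and $A^{\mathcal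 U}\cap A'$ be the relative commutants of the image of $A$ under constant sequences. * $A$ is *uniformly McDuff* if for every $d\ge 1$ there is a unital embedding ($*$-homomorphism) $M_d(\mathbb C)\to A^{\mathcal U}\cap A'$. * $\alpha$ has the *weak Rokhlin property with respect to invariant traces* if for every finite $K\subseteq G$ and every $\varepsilon>0$ there are finite sets $S_1,\dots,S_m\subseteq G$ with $\bigl|\bigcap_{k\in K\cup\{e\}}kS_i\bigr|\ge(1-\varepsilon)|S_i|$, and pairwise orthogonal positive contractions $a_{g,i}\in A^{\mathcal U}\cap A'$ ($1\le i\le m$, $g\in S_i$) such that 1. $\alpha^{\mathcal U}_g(a_{h,i})=a_{gh,i}$ whenever $g\in G$, $h\in S_i$ and $gh\in S_i$; 2. $\tau\bigl(1-\sum_{i=1}^m\sum_{g\in S_i}a_{g,i}\bigr)<\varepsilon$ for all $\tau\in T(A)^\alpha$, uniformly in $\tau$; that is, for every sequence $(\tau_n)$ in $T(A)^\alpha$, the trace $[(a_n)]\mapsto\lim_{n\to\mathcal U}\tau_n(a_n)$ on $A^{\mathcal U}$ takes a value $<\varepsilon$ at $1-\sum_{i=1}^m\sum_{g\in S_i}a_{g,i}$.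 * $(A,\alpha)$ has the *McDuff property with respect to invariant traces* if $T(A)^\alpha\neq\emptyset$ and for every $d\ge 1$ there is a unital $*$-homomorphism $M_d(\mathbb C)\to(A_{\mathcal U}\cap A')^{\alpha_{\mathcal U}}/J_{T(A)^\alpha}$, the quotient being by the intersection of $J_{T(A)^\alpha}$ with the fixed point algebra. -/

import Mathlib

open Filter Topology
open scoped ComplexOrder Pointwise BoundedContinuousFunction

noncomputable section

/-! ### Quotients of star algebras by two-sided star-closed ideals -/

/-- The ideal `I` is closed under the involution. -/
class IsStarClosed {R : Type*} [Ring R] [StarRing R] (I : Ideal R) : Prop where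
  star_mem : ∀ a ∈ I, star a ∈ I

section Quotient

variable {R : Type*} [Ring R] [StarRing R] [Algebra ℂ R] [StarModule ℂ R]

/-- The involution on the quotient by a star-closed two-sided ideal, `star [a] = [star a]`. -/
instance quotientStarRing (I : Ideal R) [I.IsTwoSided] [IsStarClosed I] : StarRing (R ⧸ I) where
  star := Quotient.map' star (fun a b h => by
    rw [Submodule.quotientRel_def] at h ⊢
    rw [← star_sub]
    exact IsStarClosed.star_mem _ h)
  star_involutive x := by
    obtain ⟨a, rfl⟩ := Ideal.Quotient.mk_surjective x
    exact congrArg (Ideal.Quotient.mk I) (star_star a)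
  star_mul x y := by
    obtain ⟨a, rfl⟩ := Ideal.Quotient.mk_surjective x
    obtain ⟨b, rfl⟩ := Ideal.Quotient.mk_surjective y
    exact congrArg (Ideal.Quotient.mk I) (star_mul a b)
  star_add x y := by
    obtain ⟨a, rfl⟩ := Ideal.Quotient.mk_surjective x
    obtain ⟨b, rfl⟩ := Ideal.Quotient.mk_surjective y
    exact congrArg (Ideal.Quotient.mk I) (star_add a b)

instance quotientStarModule (I : Ideal R) [I.IsTwoSided] [IsStarClosed I] :
    StarModule ℂ (R ⧸ I) where
  star_smul c x := by
    obtain ⟨a, rfl⟩ := Ideal.Quotient.mk_surjective x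
    exact congrArg (Ideal.Quotient.mk I) (star_smul c a)

/-- The quotient map as a unital star homomorphism. -/
def quotientMk (I : Ideal R) [I.IsTwoSided] [IsStarClosed I] : R →⋆ₐ[ℂ] R ⧸ I :=
  { Ideal.Quotient.mkₐ ℂ I with map_star' := fun _ => rfl }

/-- The map induced on a quotient by a star endomorphism preserving the ideal. -/
def quotientEnd (I : Ideal R) [I.IsTwoSided] [IsStarClosed I] (f : R →⋆ₐ[ℂ] R)
    (hf : ∀ a ∈ I, f a ∈ I) : R ⧸ I →⋆ₐ[ℂ] R ⧸ I :=
  { Ideal.quotientMapₐ I f.toAlgHom (fun a ha => hf a ha) with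
    map_star' := fun x => by
      obtain ⟨a, rfl⟩ := Ideal.Quotient.mk_surjective x
      exact congrArg (Ideal.Quotient.mk I) (map_star f a) }

/-- The restriction `S ∩ I` of an ideal `I` to a star subalgebra `S`, as an ideal of `S`. -/
abbrev restrictIdeal (S : StarSubalgebra ℂ R) (I : Ideal R) : Ideal S :=
  I.comap S.subtype

instance (S : StarSubalgebra ℂ R) (I : Ideal R) [IsStarClosed I] :
    IsStarClosed (restrictIdeal S I) where
  star_mem a ha := by
    simp only [restrictIdeal, Ideal.mem_comap] at ha ⊢
    exact IsStarClosed.star_mem (I := I) _ ha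

end Quotient

/-! ### Tracial states -/

/-- A tracial state on a unital C*-algebra: a positive linear functional `τ` with `τ 1 = 1`
and `τ (a b) = τ (b a)`. -/
structure TracialState (A : Type*) [CStarAlgebra A] extends A →ₗ[ℂ] ℂ where
  map_one' : toFun 1 = 1
  map_star_mul_self_nonneg' : ∀ a, 0 ≤ toFun (star a * a)
  map_mul_comm' : ∀ a b, toFun (a * b) = toFun (b * a)

variable {A : Type*} [CStarAlgebra A]

instance : CoeFun (TracialState A) (fun _ => A → ℂ) := ⟨fun τ => τ.toFun⟩

namespace TracialState

/-- The trace seminorm `‖a‖_{2,τ} = τ(a* a)^{1/2}`. -/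
def norm2 (τ : TracialState A) (a : A) : ℝ := Real.sqrt (τ (star a * a)).re

variable (τ : TracialState A)

theorem add (a b : A) : τ (a + b) = τ a + τ b := τ.map_add' a b
theorem sub (a b : A) : τ (a - b) = τ a - τ b := map_sub τ.toLinearMap a b
theorem smul (c : ℂ) (a : A) : τ (c • a) = c * τ a := τ.map_smul' c a
theorem comm (a b : A) : τ (a * b) = τ (b * a) := τ.map_mul_comm' a b
theorem one : τ 1 = 1 := τ.map_one'
theorem nonneg (a : A) : 0 ≤ (τ (star a * a)).re :=
  (Complex.nonneg_iff.1 (τ.map_star_mul_self_nonneg' a)).1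
theorem self_im (a : A) : (τ (star a * a)).im = 0 :=
  (Complex.nonneg_iff.1 (τ.map_star_mul_self_nonneg' a)).2.symm

theorem norm2_nonneg (a : A) : 0 ≤ τ.norm2 a := Real.sqrt_nonneg _

theorem norm2_sq (a : A) : τ.norm2 a ^ 2 = (τ (star a * a)).re := Real.sq_sqrt (τ.nonneg a)

theorem norm2_star (a : A) : τ.norm2 (star a) = τ.norm2 a := by
  unfold norm2
  rw [star_star, τ.comm]

theorem norm2_mul_le (a b : A) : τ.norm2 (a * b) ≤ ‖a‖ * τ.norm2 b := by
  let _ : PartialOrder A := CStarAlgebra.spectralOrder A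
  let _ : StarOrderedRing A := CStarAlgebra.spectralOrderedRing A
  have h0 : 0 ≤ algebraMap ℝ A (‖a‖ ^ 2) - star a * a :=
    sub_nonneg.2 CStarAlgebra.star_mul_le_algebraMap_norm_sq
  obtain ⟨c, hc⟩ := CStarAlgebra.nonneg_iff_eq_star_mul_self.1 h0
  have h1 := τ.nonneg (c * b)
  have h2 : star (c * b) * (c * b)
      = ((‖a‖ ^ 2 : ℝ) : ℂ) • (star b * b) - star (a * b) * (a * b) := by
    have : star (c * b) * (c * b) = star b * (star c * c) * b := by
      simp only [star_mul, mul_assoc]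
    rw [this, ← hc, Algebra.algebraMap_eq_smul_one, ← Complex.coe_smul]
    simp only [star_mul, mul_sub, sub_mul, mul_assoc, smul_mul_assoc, mul_smul_comm, one_mul]
  rw [h2, τ.sub, τ.smul] at h1
  simp only [Complex.sub_re, Complex.re_ofReal_mul] at h1
  rw [← τ.norm2_sq, ← τ.norm2_sq] at h1
  refine le_of_sq_le_sq ?_ (mul_nonneg (norm_nonneg _) (τ.norm2_nonneg b))
  rw [mul_pow]
  linarith

theorem norm2_mul_le' (a b : A) : τ.norm2 (a * b) ≤ ‖b‖ * τ.norm2 a := by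
  rw [← norm2_star, star_mul, ← norm_star b, ← τ.norm2_star a]
  exact τ.norm2_mul_le _ _

theorem norm2_one : τ.norm2 1 = 1 := by
  simp [norm2, τ.one]

theorem norm2_le_norm (a : A) : τ.norm2 a ≤ ‖a‖ := by
  have := τ.norm2_mul_le a 1
  rwa [mul_one, norm2_one, mul_one] at this

theorem norm2_add_le (a b : A) : τ.norm2 (a + b) ≤ 2 * (τ.norm2 a + τ.norm2 b) := by
  have h1 := τ.nonneg (a - b)
  have h2 : star (a + b) * (a + b) + star (a - b) * (a - b)
      = (2 : ℂ) • (star a * a) + (2 : ℂ) • (star b * b) := by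
    simp only [star_add, star_sub, two_smul]
    noncomm_ring
  have h3 := congrArg (fun x => (τ x).re) h2
  simp only [τ.add, τ.smul, Complex.add_re] at h3
  have e : ∀ z : ℂ, (2 * z).re = 2 * z.re := fun z => by simp
  rw [e, e, ← τ.norm2_sq, ← τ.norm2_sq, ← τ.norm2_sq, ← τ.norm2_sq] at h3
  have h4 := sq_nonneg (τ.norm2 (a - b))
  have ha := τ.norm2_nonneg a
  have hb := τ.norm2_nonneg b
  refine le_of_sq_le_sq ?_ (by positivity)
  nlinarith [mul_nonneg ha hb]

theorem norm_apply_le_norm2 (a : A) : ‖τ a‖ ≤ τ.norm2 a := by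
  have h1 := τ.nonneg (a - τ a • 1)
  have hs : τ (star a) = star (τ a) := by
    have k1 := τ.self_im (a + 1)
    have k2 := τ.self_im (a + Complex.I • 1)
    simp only [star_add, star_smul, star_one, add_mul, mul_add, mul_one, one_mul, τ.add, τ.smul,
      smul_mul_assoc, mul_smul_comm, τ.one, Complex.add_im, τ.self_im a, Complex.star_def,
      Complex.conj_I, Complex.mul_im, Complex.neg_re, Complex.neg_im, Complex.I_re, Complex.I_im,
      Complex.one_im] at k1 k2
    apply Complex.ext
    · rw [Complex.star_def, Complex.conj_re]
      linarith
    · rw [Complex.star_def, Complex.conj_im]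
      linarith
  have h2 : (τ (star (a - τ a • 1) * (a - τ a • 1))).re = τ.norm2 a ^ 2 - ‖τ a‖ ^ 2 := by
    rw [norm2_sq, ← Complex.normSq_eq_norm_sq, Complex.normSq_apply]
    simp only [star_sub, star_smul, star_one, sub_mul, mul_sub, mul_one, one_mul, τ.sub, τ.smul,
      smul_mul_assoc, mul_smul_comm, τ.one, hs, Complex.sub_re, Complex.star_def,
      Complex.mul_re, Complex.conj_re, Complex.conj_im]
    ring
  rw [h2] at h1
  exact le_of_sq_le_sq (by linarith) (τ.norm2_nonneg a)

/-- The trace `τ ∘ φ`. -/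
def comp (φ : A ≃⋆ₐ[ℂ] A) : TracialState A where
  toLinearMap := τ.toLinearMap ∘ₗ (φ : A →ₐ[ℂ] A).toLinearMap
  map_one' := by
    change τ (φ 1) = 1
    rw [map_one, τ.one]
  map_star_mul_self_nonneg' a := by
    change 0 ≤ τ (φ (star a * a))
    rw [map_mul, map_star]
    exact τ.map_star_mul_self_nonneg' _
  map_mul_comm' a b := by
    change τ (φ (a * b)) = τ (φ (b * a))
    rw [map_mul, map_mul, τ.comm]

theorem comp_norm2 (φ : A ≃⋆ₐ[ℂ] A) (a : A) : (τ.comp φ).norm2 a = τ.norm2 (φ a) := by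
  unfold norm2
  rw [← map_star, ← map_mul]
  rfl

end TracialState

/-- The uniform trace seminorm `‖a‖_{2,T} = sup_{τ ∈ T} ‖a‖_{2,τ}`. -/
def norm2Sup (T : Set (TracialState A)) (a : A) : ℝ := ⨆ τ : T, (τ : TracialState A).norm2 a

section norm2Sup

variable (T : Set (TracialState A))

theorem norm2Sup_bdd (a : A) :
    BddAbove (Set.range fun τ : T => (τ : TracialState A).norm2 a) :=
  ⟨‖a‖, by rintro _ ⟨τ, rfl⟩; exact τ.1.norm2_le_norm a⟩

theorem le_norm2Sup {τ : TracialState A} (h : τ ∈ T) (a : A) : τ.norm2 a ≤ norm2Sup T a :=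
  le_ciSup (norm2Sup_bdd T a) ⟨τ, h⟩

theorem norm2Sup_nonneg (a : A) : 0 ≤ norm2Sup T a :=
  Real.iSup_nonneg fun τ => τ.1.norm2_nonneg a

theorem norm2Sup_le {a : A} {c : ℝ} (hc : 0 ≤ c) (h : ∀ τ ∈ T, τ.norm2 a ≤ c) :
    norm2Sup T a ≤ c :=
  Real.iSup_le (fun τ => h τ.1 τ.2) hc

theorem norm2Sup_le_norm (a : A) : norm2Sup T a ≤ ‖a‖ :=
  norm2Sup_le T (norm_nonneg a) fun τ _ => τ.norm2_le_norm a

end norm2Sup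

/-! ### Ultrapowers -/

/-- The C*-algebra `ℓ^∞(A)` of bounded sequences in `A` (`ℕ` being discrete, every bounded
sequence is a bounded continuous function) with the supremum norm and pointwise operations. -/
abbrev EllInfty (A : Type*) [CStarAlgebra A] : Type _ := ℕ →ᵇ A

variable (U : Ultrafilter ℕ)

/-- The ideal `c_U(A)` of bounded sequences with `lim_{n → U} ‖a_n‖ = 0`. -/
def cIdeal (A : Type*) [CStarAlgebra A] : Ideal (EllInfty A) where
  carrier := {a | Tendsto (fun n => ‖a n‖) U (𝓝 0)}
  zero_mem' := by simp
  add_mem' {a b} ha hb := by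
    have h := Tendsto.add ha hb
    rw [add_zero] at h
    exact squeeze_zero (fun _ => norm_nonneg _) (fun n => norm_add_le (a n) (b n)) h
  smul_mem' c a ha := by
    have h := Tendsto.const_mul ‖c‖ ha
    rw [mul_zero] at h
    refine squeeze_zero (fun _ => norm_nonneg _) (fun n => ?_) h
    exact (norm_mul_le (c n) (a n)).trans
      (mul_le_mul_of_nonneg_right (c.norm_coe_le_norm n) (norm_nonneg _))

theorem mem_cIdeal {a : EllInfty A} :
    a ∈ cIdeal U A ↔ Tendsto (fun n => ‖a n‖) U (𝓝 0) := Iff.rfl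

instance : (cIdeal U A).IsTwoSided where
  mul_mem_of_left {a} c ha := by
    have h := Tendsto.mul_const ‖c‖ ((mem_cIdeal U).1 ha)
    rw [zero_mul] at h
    refine squeeze_zero (fun _ => norm_nonneg _) (fun n => ?_) h
    exact (norm_mul_le (a n) (c n)).trans
      (mul_le_mul_of_nonneg_left (c.norm_coe_le_norm n) (norm_nonneg _))

instance : IsStarClosed (cIdeal U A) where
  star_mem a ha := by
    rw [mem_cIdeal] at ha ⊢
    simpa using ha

/-- The norm ultrapower `A_U = ℓ^∞(A) / c_U(A)`. -/
abbrev NormUltrapower (A : Type*) [CStarAlgebra A] : Type _ := EllInfty A ⧸ cIdeal U A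

/-- The class in `A_U` of a bounded sequence. -/
abbrev normClass : EllInfty A →⋆ₐ[ℂ] NormUltrapower U A := quotientMk (cIdeal U A)

theorem normClass_surjective : Function.Surjective (normClass U (A := A)) :=
  Ideal.Quotient.mk_surjective

theorem normClass_eq_iff {a b : EllInfty A} :
    normClass U a = normClass U b ↔ a - b ∈ cIdeal U A := Ideal.Quotient.eq

theorem tendsto_norm2Sup_of_cIdeal (T : Set (TracialState A)) {a : EllInfty A}
    (ha : a ∈ cIdeal U A) : Tendsto (fun n => norm2Sup T (a n)) U (𝓝 0) :=
  squeeze_zero (fun _ => norm2Sup_nonneg T _) (fun _ => norm2Sup_le_norm T _) ha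

theorem tendsto_norm2Sup_add (T : Set (TracialState A)) {a b : EllInfty A}
    (ha : Tendsto (fun n => norm2Sup T (a n)) U (𝓝 0))
    (hb : Tendsto (fun n => norm2Sup T (b n)) U (𝓝 0)) :
    Tendsto (fun n => norm2Sup T ((a + b) n)) U (𝓝 0) := by
  have h := (Tendsto.add ha hb).const_mul 2
  rw [add_zero, mul_zero] at h
  refine squeeze_zero (fun _ => norm2Sup_nonneg T _) (fun n => ?_) h
  refine norm2Sup_le T ?_ fun τ hτ => (τ.norm2_add_le (a n) (b n)).trans ?_
  · have := norm2Sup_nonneg T (a n)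
    have := norm2Sup_nonneg T (b n)
    positivity
  · have := le_norm2Sup T hτ (a n)
    have := le_norm2Sup T hτ (b n)
    linarith

/-- The trace-kernel ideal `J_T` of `A_U`, consisting of the classes of bounded sequences with
`lim_{n → U} ‖a_n‖_{2,T} = 0`. -/
def traceIdeal (T : Set (TracialState A)) : Ideal (NormUltrapower U A) where
  carrier := {x | ∃ a : EllInfty A, normClass U a = x ∧
    Tendsto (fun n => norm2Sup T (a n)) U (𝓝 0)}
  zero_mem' := ⟨0, map_zero _, tendsto_norm2Sup_of_cIdeal U T (Submodule.zero_mem _)⟩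
  add_mem' := by
    rintro _ _ ⟨a, rfl, ha⟩ ⟨b, rfl, hb⟩
    exact ⟨a + b, map_add _ _ _, tendsto_norm2Sup_add U T ha hb⟩
  smul_mem' := by
    rintro c _ ⟨a, rfl, ha⟩
    obtain ⟨c, rfl⟩ := normClass_surjective U c
    refine ⟨c * a, map_mul _ _ _, ?_⟩
    have h := Tendsto.const_mul ‖c‖ ha
    rw [mul_zero] at h
    refine squeeze_zero (fun _ => norm2Sup_nonneg T _) (fun n => ?_) h
    refine norm2Sup_le T (mul_nonneg (norm_nonneg _) (norm2Sup_nonneg T _)) fun τ hτ => ?_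
    exact (τ.norm2_mul_le (c n) (a n)).trans
      (mul_le_mul (c.norm_coe_le_norm n) (le_norm2Sup T hτ _) (τ.norm2_nonneg _) (norm_nonneg _))

/-- Membership in `J_T` may be tested on any representing sequence. -/
theorem normClass_mem_traceIdeal (T : Set (TracialState A)) (a : EllInfty A) :
    normClass U a ∈ traceIdeal U T ↔ Tendsto (fun n => norm2Sup T (a n)) U (𝓝 0) := by
  refine ⟨?_, fun h => ⟨a, rfl, h⟩⟩
  rintro ⟨b, hb, h⟩
  rw [eq_comm, normClass_eq_iff] at hb
  have := tendsto_norm2Sup_add U T (tendsto_norm2Sup_of_cIdeal U T hb) h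
  simpa using this

instance (T : Set (TracialState A)) : (traceIdeal U T).IsTwoSided where
  mul_mem_of_left := by
    rintro _ c ⟨a, rfl, ha⟩
    obtain ⟨c, rfl⟩ := normClass_surjective U c
    refine ⟨a * c, map_mul _ _ _, ?_⟩
    have h := Tendsto.const_mul ‖c‖ ha
    rw [mul_zero] at h
    refine squeeze_zero (fun _ => norm2Sup_nonneg T _) (fun n => ?_) h
    refine norm2Sup_le T (mul_nonneg (norm_nonneg _) (norm2Sup_nonneg T _)) fun τ hτ => ?_
    exact (τ.norm2_mul_le' (a n) (c n)).trans
      (mul_le_mul (c.norm_coe_le_norm n) (le_norm2Sup T hτ _) (τ.norm2_nonneg _) (norm_nonneg _))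

instance (T : Set (TracialState A)) : IsStarClosed (traceIdeal U T) where
  star_mem := by
    rintro _ ⟨a, rfl, ha⟩
    refine ⟨star a, map_star _ _, ?_⟩
    have : (fun n => norm2Sup T ((star a : EllInfty A) n)) = fun n => norm2Sup T (a n) := by
      funext n
      simp only [norm2Sup, BoundedContinuousFunction.star_apply, TracialState.norm2_star]
    rw [this]
    exact ha

/-- The uniform tracial ultrapower `A^U = A_U / J_{T(A)}`. -/
abbrev TracialUltrapower (A : Type*) [CStarAlgebra A] : Type _ :=
  NormUltrapower U A ⧸ traceIdeal U (Set.univ : Set (TracialState A))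

/-- The quotient map `A_U → A^U`. -/
abbrev kappa : NormUltrapower U A →⋆ₐ[ℂ] TracialUltrapower U A :=
  quotientMk (traceIdeal U (Set.univ : Set (TracialState A)))

/-- The class in `A^U` of a bounded sequence. -/
abbrev tracialClass : EllInfty A →⋆ₐ[ℂ] TracialUltrapower U A := (kappa U).comp (normClass U)

theorem tracialClass_surjective : Function.Surjective (tracialClass U (A := A)) :=
  Ideal.Quotient.mk_surjective.comp (normClass_surjective U)

/-- The relative commutant `A_U ∩ A'` of the constant sequences in `A_U`. -/
def normCentral (A : Type*) [CStarAlgebra A] : StarSubalgebra ℂ (NormUltrapower U A) :=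
  StarSubalgebra.centralizer ℂ
    (Set.range fun a : A => normClass U (BoundedContinuousFunction.const ℕ a))

/-- The relative commutant `A^U ∩ A'` of the image of `A` in `A^U`. -/
def tracialCentral (A : Type*) [CStarAlgebra A] : StarSubalgebra ℂ (TracialUltrapower U A) :=
  StarSubalgebra.centralizer ℂ
    (Set.range fun a : A => tracialClass U (BoundedContinuousFunction.const ℕ a))

/-! ### Evaluating limits of traces on the uniform tracial ultrapower -/

/-- The limit trace on `A^U` given by a sequence `τ_n` of traces of `A`: the class of `(a_n)` is
sent to `lim_{n → U} τ_n(a_n)`. For a constant sequence `τ_n = τ` this is the canonical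
extension of `τ` to `A^U`. The value does not depend on the representing sequence that is
chosen, see `tendsto_limitTrace`. -/
def limitTrace (τ : ℕ → TracialState A) (x : TracialUltrapower U A) : ℂ :=
  limUnder (U : Filter ℕ) fun n => τ n (Function.surjInv (tracialClass_surjective U) x n)

theorem tendsto_limitTrace (τ : ℕ → TracialState A) (a : EllInfty A) :
    Tendsto (fun n => τ n (a n)) U (𝓝 (limitTrace U τ (tracialClass U a))) := by
  set b := Function.surjInv (tracialClass_surjective U) (tracialClass U a) with hb
  have hb' : tracialClass U b = tracialClass U a := Function.surjInv_eq _ _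
  have h1 : Tendsto (fun n => τ n (b n)) U (𝓝 (limitTrace U τ (tracialClass U a))) := by
    have hc : IsCompact (Metric.closedBall (0 : ℂ) ‖b‖) := isCompact_closedBall _ _
    obtain ⟨z, -, hz⟩ := hc.ultrafilter_le_nhds (U.map fun n => τ n (b n)) (by
      rw [le_principal_iff]
      refine Filter.mem_map.2 (Eventually.of_forall fun n => ?_)
      change τ n (b n) ∈ Metric.closedBall (0 : ℂ) ‖b‖
      rw [mem_closedBall_zero_iff]
      exact ((τ n).norm_apply_le_norm2 _).trans
        (((τ n).norm2_le_norm _).trans (b.norm_coe_le_norm n)))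
    exact tendsto_nhds_limUnder ⟨z, hz⟩
  have h2 : normClass U (a - b) ∈ traceIdeal U (Set.univ : Set (TracialState A)) := by
    rw [map_sub]
    exact Ideal.Quotient.eq.1 hb'.symm
  rw [normClass_mem_traceIdeal] at h2
  have h3 : Tendsto (fun n => τ n ((a - b) n)) U (𝓝 0) :=
    squeeze_zero_norm (fun n => ((τ n).norm_apply_le_norm2 _).trans
      (le_norm2Sup _ (Set.mem_univ _) _)) h2
  have h4 := h3.add h1
  rw [zero_add] at h4
  refine h4.congr fun n => ?_
  rw [← (τ n).add]
  simp

/-! ### Group actions -/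

/-- A star automorphism of `A` applied to the entries of bounded sequences. -/
def ellInftyMap (φ : A ≃⋆ₐ[ℂ] A) : EllInfty A →⋆ₐ[ℂ] EllInfty A where
  toFun a := BoundedContinuousFunction.ofNormedAddCommGroup (fun n => φ (a n))
    continuous_of_discreteTopology ‖a‖ fun n => by
      rw [StarAlgEquiv.norm_map]
      exact a.norm_coe_le_norm n
  map_one' := by ext n; simp
  map_mul' a b := by ext n; simp
  map_zero' := by ext n; simp
  map_add' a b := by ext n; simp
  commutes' c := by
    ext n
    exact AlgHomClass.commutes φ c
  map_star' a := by
    ext n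
    exact map_star φ (a n)

@[simp] theorem ellInftyMap_apply (φ : A ≃⋆ₐ[ℂ] A) (a : EllInfty A) (n : ℕ) :
    ellInftyMap φ a n = φ (a n) := rfl

/-- The automorphism `φ` acting coordinatewise on `A_U`. -/
def normUltraMap (φ : A ≃⋆ₐ[ℂ] A) : NormUltrapower U A →⋆ₐ[ℂ] NormUltrapower U A :=
  quotientEnd (cIdeal U A) (ellInftyMap φ) fun a ha => by
    rw [mem_cIdeal] at ha ⊢
    simpa only [ellInftyMap_apply, StarAlgEquiv.norm_map] using ha

theorem normUltraMap_normClass (φ : A ≃⋆ₐ[ℂ] A) (a : EllInfty A) :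
    normUltraMap U φ (normClass U a) = normClass U (ellInftyMap φ a) := rfl

/-- The automorphism `φ` acting coordinatewise on `A^U`. -/
def tracialUltraMap (φ : A ≃⋆ₐ[ℂ] A) : TracialUltrapower U A →⋆ₐ[ℂ] TracialUltrapower U A :=
  quotientEnd (traceIdeal U Set.univ) (normUltraMap U φ) fun x hx => by
    obtain ⟨a, rfl⟩ := normClass_surjective U x
    rw [normUltraMap_normClass]
    rw [normClass_mem_traceIdeal] at hx ⊢
    refine squeeze_zero (fun _ => norm2Sup_nonneg _ _) (fun n => ?_) hx
    refine norm2Sup_le _ (norm2Sup_nonneg _ _) fun τ _ => ?_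
    rw [ellInftyMap_apply, ← TracialState.comp_norm2]
    exact le_norm2Sup _ (Set.mem_univ _) _

theorem tracialUltraMap_tracialClass (φ : A ≃⋆ₐ[ℂ] A) (a : EllInfty A) :
    tracialUltraMap U φ (tracialClass U a) = tracialClass U (ellInftyMap φ a) := rfl

variable {G : Type*} [Group G] (α : G →* (A ≃⋆ₐ[ℂ] A))

/-- The set `T(A)^α` of `α`-invariant traces. -/
def invariantTraces : Set (TracialState A) := {τ | ∀ (g : G) (a : A), τ (α g a) = τ a}

/-- The fixed point algebra `(A_U ∩ A')^{α_U}`. -/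
def fixedNormCentral : StarSubalgebra ℂ (NormUltrapower U A) :=
  normCentral U A ⊓ ⨅ g : G, StarAlgHom.equalizer (normUltraMap U (α g)) (StarAlgHom.id ℂ _)

/-- `(A, α)` has the McDuff property with respect to invariant traces: `T(A)^α` is non-empty and
for every `d ≥ 1` there is a unital star homomorphism `M_d → (A_U ∩ A')^{α_U} / J_{T(A)^α}`. -/
def McDuffInvariantTraces : Prop :=
  (invariantTraces α).Nonempty ∧
    ∀ d : ℕ, 1 ≤ d → Nonempty (Matrix (Fin d) (Fin d) ℂ →⋆ₐ[ℂ]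
      (fixedNormCentral U α ⧸
        restrictIdeal (fixedNormCentral U α) (traceIdeal U (invariantTraces α))))

/-- `A` is uniformly McDuff: for every `d ≥ 1` there is a unital embedding
`M_d → A^U ∩ A'`. -/
def UniformlyMcDuff (A : Type*) [CStarAlgebra A] : Prop :=
  ∀ d : ℕ, 1 ≤ d → ∃ φ : Matrix (Fin d) (Fin d) ℂ →⋆ₐ[ℂ] tracialCentral U A,
    Function.Injective φ

/-- `S` is `(K, ε)`-invariant: `|⋂_{k ∈ K ∪ {e}} k S| ≥ (1 - ε) |S|`. -/
def IsInvariantShape (K : Finset G) (ε : ℝ) (S : Finset G) : Prop :=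
  (1 - ε) * (S.card : ℝ) ≤ ((⋂ k ∈ insert 1 (K : Set G), k • (S : Set G)).ncard : ℝ)

/-- Positive contractions `0 ≤ x ≤ 1` of a unital C*-algebra, where an element is positive if it
is of the form `y* y`. -/
def IsPositiveContraction {B : Type*} [Ring B] [StarRing B] (x : B) : Prop :=
  (∃ y, x = star y * y) ∧ ∃ y, 1 - x = star y * y

/-- The weak Rokhlin property with respect to invariant traces. The remainder of the towers is
small uniformly over invariant traces: it is small in every limit trace coming from a sequence
of invariant traces. -/
def WeakRokhlinInvariantTraces : Prop :=
  ∀ (K : Finset G) (ε : ℝ), 0 < ε →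
    ∃ (m : ℕ) (S : Fin m → Finset G) (a : Fin m → G → TracialUltrapower U A),
      (∀ i, IsInvariantShape K ε (S i)) ∧
      (∀ i, ∀ g ∈ S i, a i g ∈ tracialCentral U A ∧ IsPositiveContraction (a i g)) ∧
      (∀ i, ∀ g ∈ S i, ∀ j, ∀ h ∈ S j, (i, g) ≠ (j, h) → a i g * a j h = 0) ∧
      (∀ i, ∀ g : G, ∀ h ∈ S i, g * h ∈ S i →
        tracialUltraMap U (α g) (a i h) = a i (g * h)) ∧
      (∀ τ : ℕ → TracialState A, (∀ n, τ n ∈ invariantTraces α) →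
        (limitTrace U τ (1 - ∑ i, ∑ g ∈ S i, a i g)).re < ε)

/-- A discrete group is amenable if there is a left-invariant mean on the bounded real functions
on it. (Values of `m` at unbounded functions are irrelevant.) -/
def IsAmenableGroup (G : Type*) [Group G] : Prop :=
  ∃ m : (G → ℝ) → ℝ, m 1 = 1 ∧
    (∀ f : G → ℝ, (∃ C, ∀ g, |f g| ≤ C) →
      ((∀ g, 0 ≤ f g) → 0 ≤ m f) ∧
      (∀ c : ℝ, m (c • f) = c * m f) ∧
      (∀ f' : G → ℝ, (∃ C, ∀ g, |f' g| ≤ C) → m (f + f') = m f + m f') ∧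
      (∀ h : G, m (fun g => f (h * g)) = m f))

end

/-!
Averaging a trace by an invariant mean gives an invariant trace, so `X = T(A)^α` is non-empty. A
unital star homomorphism on `M_d` is the same as a system of matrix units, so it remains to find
bounded sequences of families in `A` that satisfy the matrix unit relations modulo `J_X`, and that
are, in norm along `U`, central and fixed by `α`. Since unitaries span `A`, centrality means being
fixed by countably many inner automorphisms, and is treated on the same footing as invariance.

*Gluing.* Let `a_{g,i}` be Rokhlin towers and `s` their sum. A reindexing argument yields matrix
units `e` in `A^U ∩ A'` for which `α_g(e)` commutes with `a_{g,i}`. Then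
`E = ∑ a_{g,i} α_g(e)` satisfies the matrix unit relations up to terms with a factor `1 - s`, which
are small in the trace norm of every invariant limit trace
(`IsOrthogonalFamily.trace_matrixDefect_le`). By equivariance, `α_k(E) - E` lives over the
boundaries `S_i \ kS_i` and `kS_i \ S_i` of the shapes. An invariant trace is constant along each
tower, so this is small too (`trace_glue_sub_le`). No functional calculus in `A^U` is needed: every
positivity statement is an explicit sum of hermitian squares, and so is `1 - E* E ≥ 0`, which
bounds `E`.

*Quasi-invariant approximate units.* Given finitely many automorphisms `β` of a C*-algebra that
preserve a closed ideal `I`, one finds `b ∈ I` above any given positive element of `I` such that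
`β b ≤ C b` for all of them. Operator monotonicity of the square root gives
`β h ≤ C^(2⁻ᵏ) h` for `h = b^(2⁻ᵏ)`, so that for large `k` the element `h` is almost fixed in norm,
and it is almost a unit for every element dominated by `b`
(`exists_quasi_invariant_approximate_unit`).

Such units serve twice. Without automorphisms, replacing `y` by `y (1 - h)` lifts the contraction
`E` to a sequence of norm at most `2` (`exists_bounded_lift`), a bound independent of the precision
of the towers, so that a diagonal sequence (`exists_diagonal`) has exact relations modulo `J_X`
(`exists_invariant_matrixUnits`). With automorphisms, replacing `x` by `(1 - h) x (1 - h)` turns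
invariance modulo `J_X` into invariance in norm (`exists_norm_invariant_matrixUnits`).
-/

noncomputable section

/-! ### Sums of hermitian squares -/

section PosCone

variable {R S : Type*} [Ring R] [StarRing R] [Ring S] [StarRing S]

/-- The cone of finite sums of elements `w* w` in a star ring. -/
def posCone (R : Type*) [Ring R] [StarRing R] : AddSubmonoid R :=
  AddSubmonoid.closure (Set.range fun w : R => star w * w)

theorem star_mul_self_mem_posCone (w : R) : star w * w ∈ posCone R :=
  AddSubmonoid.subset_closure ⟨w, rfl⟩

theorem conj_mem_posCone {x : R} (hx : x ∈ posCone R) (c : R) : star c * x * c ∈ posCone R := by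
  induction hx using AddSubmonoid.closure_induction with
  | mem x hx =>
    obtain ⟨w, rfl⟩ := hx
    have : star c * (star w * w) * c = star (w * c) * (w * c) := by
      simp only [star_mul, mul_assoc]
    simp only [this]
    exact star_mul_self_mem_posCone _
  | zero => simp
  | add x y _ _ hx hy =>
    rw [mul_add, add_mul]
    exact add_mem hx hy

theorem isSelfAdjoint_of_mem_posCone {x : R} (hx : x ∈ posCone R) : star x = x := by
  induction hx using AddSubmonoid.closure_induction with
  | mem x hx =>
    obtain ⟨w, rfl⟩ := hx
    simp
  | zero => simp
  | add x y _ _ hx hy => rw [star_add, hx, hy]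

theorem map_nonneg_of_mem_posCone {t : R →+ ℝ} (ht : ∀ x, 0 ≤ t (star x * x)) {x : R}
    (hx : x ∈ posCone R) : 0 ≤ t x := by
  induction hx using AddSubmonoid.closure_induction with
  | mem x hx =>
    obtain ⟨w, rfl⟩ := hx
    exact ht w
  | zero => simp
  | add x y _ _ hx hy =>
    rw [map_add]
    exact add_nonneg hx hy

/-- An element of the interval `[0, 1]` dominates its square: indeed
`a - a² = a (1 - a) a + (1 - a) a (1 - a)`. -/
theorem sub_sq_mem_posCone {a : R} (ha : a ∈ posCone R) (ha' : 1 - a ∈ posCone R) :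
    a - a * a ∈ posCone R := by
  have h1 := conj_mem_posCone ha' a
  have h2 := conj_mem_posCone ha (1 - a)
  rw [isSelfAdjoint_of_mem_posCone ha] at h1
  rw [isSelfAdjoint_of_mem_posCone ha'] at h2
  convert add_mem h1 h2 using 1
  noncomm_ring

end PosCone

/-! ### Matrix units -/

section MatrixUnits

/-- An index for each of the defining relations of a system of `d × d` matrix units. -/
abbrev MatrixRel (d : ℕ) : Type :=
  (Fin d × Fin d × Fin d × Fin d) ⊕ (Fin d × Fin d) ⊕ Unit

/-- The amount by which a family `e` fails a given matrix unit relation. -/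
def matrixDefect {R : Type*} [Ring R] [StarRing R] {d : ℕ} (e : Fin d → Fin d → R) :
    MatrixRel d → R
  | .inl (k, l, m, n) => e k l * e m n - if l = m then e k n else 0
  | .inr (.inl (k, l)) => star (e k l) - e l k
  | .inr (.inr _) => ∑ k, e k k - 1

variable {R S : Type*} [Ring R] [StarRing R] [Ring S] [StarRing S] {d : ℕ}

/-- A star homomorphism carries matrix unit defects to matrix unit defects. -/
theorem map_matrixDefect {F : Type*} [FunLike F R S] [RingHomClass F R S] [StarHomClass F R S]
    (φ : F) (e : Fin d → Fin d → R) (r : MatrixRel d) :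
    φ (matrixDefect e r) = matrixDefect (fun k l => φ (e k l)) r := by
  rcases r with ⟨k, l, m, n⟩ | ⟨k, l⟩ | _ <;> simp only [matrixDefect, map_sub, map_mul, map_star,
    map_sum, map_one]
  split_ifs <;> simp

variable {e : Fin d → Fin d → R} (he : ∀ r, matrixDefect e r = 0)

include he

theorem matrixUnit_mul (k l m n : Fin d) : e k l * e m n = if l = m then e k n else 0 :=
  sub_eq_zero.1 (he (.inl (k, l, m, n)))

theorem matrixUnit_star (k l : Fin d) : star (e k l) = e l k :=
  sub_eq_zero.1 (he (.inr (.inl (k, l))))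

theorem matrixUnit_sum : ∑ k, e k k = 1 :=
  sub_eq_zero.1 (he (.inr (.inr ())))

/-- The unital star homomorphism defined on `M_d(ℂ)` by a system of matrix units. -/
theorem exists_starAlgHom_of_matrixUnits [Algebra ℂ R] [StarModule ℂ R] :
    Nonempty (Matrix (Fin d) (Fin d) ℂ →⋆ₐ[ℂ] R) := by
  let L : Matrix (Fin d) (Fin d) ℂ →ₗ[ℂ] R :=
    { toFun := fun M => ∑ k, ∑ l, M k l • e k l
      map_add' := fun M N => by
        simp only [Matrix.add_apply, add_smul, Finset.sum_add_distrib]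
      map_smul' := fun c M => by
        simp only [Matrix.smul_apply, smul_eq_mul, mul_smul, Finset.smul_sum, RingHom.id_apply] }
  have hL : ∀ M, L M = ∑ k, ∑ l, M k l • e k l := fun _ => rfl
  have h1 : L 1 = 1 := by
    rw [hL, ← matrixUnit_sum he]
    refine Finset.sum_congr rfl fun k _ => ?_
    rw [Finset.sum_eq_single k (fun l _ h => by rw [Matrix.one_apply_ne h.symm, zero_smul])
      (fun h => absurd (Finset.mem_univ k) h), Matrix.one_apply_eq, one_smul]
  have hmul : ∀ M N, L (M * N) = L M * L N := by
    intro M N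
    simp only [hL, Finset.sum_mul, Finset.mul_sum, smul_mul_smul_comm, matrixUnit_mul he,
      Matrix.mul_apply, Finset.sum_smul]
    simp only [smul_ite, smul_zero, Finset.sum_ite_eq', Finset.mem_univ, if_true]
    rw [Finset.sum_comm_cycle]
    exact Finset.sum_congr rfl fun b _ => Finset.sum_comm
  refine ⟨{ AlgHom.ofLinearMap L h1 hmul with map_star' := fun M => ?_ }⟩
  change L (star M) = star (L M)
  simp only [hL, star_sum, star_smul, matrixUnit_star he, Matrix.star_apply]
  exact Finset.sum_comm

end MatrixUnits

/-! ### Gluing matrix units along towers -/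

section Towers

variable {Q : Type*} [Ring Q] [StarRing Q]

/-- A positive trace, encoded by its real part, an additive map to `ℝ`. -/
structure IsRealTrace (t : Q →+ ℝ) : Prop where
  nonneg : ∀ x, 0 ≤ t (star x * x)
  comm : ∀ x y, t (x * y) = t (y * x)

namespace IsRealTrace

variable {t : Q →+ ℝ} (ht : IsRealTrace t)

include ht

theorem nonneg_of_mem {x : Q} (hx : x ∈ posCone Q) : 0 ≤ t x :=
  map_nonneg_of_mem_posCone ht.nonneg hx

theorem sub_le (x y : Q) :
    t (star (x - y) * (x - y)) ≤ 2 * t (star x * x) + 2 * t (star y * y) := by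
  have h := ht.nonneg (x + y)
  have e : star (x - y) * (x - y) + star (x + y) * (x + y)
      = star x * x + star x * x + (star y * y + star y * y) := by
    simp only [star_add, star_sub]
    noncomm_ring
  have := congrArg t e
  simp only [map_add] at this
  linarith

/-- If `y y* ≤ 1` then `‖x y‖_{2,t} ≤ ‖x‖_{2,t}`. -/
theorem mul_le {y : Q} (hy : 1 - y * star y ∈ posCone Q) (x : Q) :
    t (star (x * y) * (x * y)) ≤ t (star x * x) := by
  have h1 := ht.nonneg_of_mem (conj_mem_posCone hy (star x))
  rw [star_star, mul_sub, sub_mul, map_sub, mul_one] at h1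
  have h2 : t (star (x * y) * (x * y)) = t (x * (y * star y) * star x) := by
    rw [ht.comm]
    simp only [star_mul, mul_assoc]
  rw [h2, ht.comm (star x)]
  linarith

end IsRealTrace

variable {ι : Type*}

/-- Pairwise orthogonal positive contractions commuting with matrix units of the same index. -/
structure IsOrthogonalFamily {d : ℕ} (a : ι → Q) (e : ι → Fin d → Fin d → Q) : Prop where
  pos : ∀ i, a i ∈ posCone Q
  pos' : ∀ i, 1 - a i ∈ posCone Q
  orth : ∀ i j, i ≠ j → a i * a j = 0
  unit : ∀ i r, matrixDefect (e i) r = 0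
  comm : ∀ i k l, a i * e i k l = e i k l * a i

namespace IsOrthogonalFamily

variable {d : ℕ} {a : ι → Q} {e : ι → Fin d → Fin d → Q} (h : IsOrthogonalFamily a e)

include h

theorem star_a (i : ι) : star (a i) = a i := isSelfAdjoint_of_mem_posCone (h.pos i)

theorem sum_mul_sum (s : Finset ι) {x y : ι → Q} (hx : ∀ i, a i * x i = x i * a i) :
    (∑ i ∈ s, a i * x i) * ∑ i ∈ s, a i * y i = ∑ i ∈ s, a i * a i * (x i * y i) := by
  rw [Finset.sum_mul]
  refine Finset.sum_congr rfl fun i hi => ?_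
  rw [Finset.mul_sum, Finset.sum_eq_single i]
  · rw [mul_assoc, ← mul_assoc (x i), ← hx]
    simp only [mul_assoc]
  · intro j _ hj
    rw [hx, mul_assoc, ← mul_assoc (a i), h.orth i j hj.symm, zero_mul, mul_zero]
  · exact fun h => absurd hi h

theorem sum_sub_sq_mem (s : Finset ι) : ∑ i ∈ s, (a i - a i * a i) ∈ posCone Q :=
  sum_mem fun i _ => sub_sq_mem_posCone (h.pos i) (h.pos' i)

theorem sum_sq (s : Finset ι) : (∑ i ∈ s, a i) * ∑ i ∈ s, a i = ∑ i ∈ s, a i * a i := by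
  simpa using h.sum_mul_sum s (x := 1) (y := 1) (by simp)

theorem star_sum_a (s : Finset ι) : star (∑ i ∈ s, a i) = ∑ i ∈ s, a i := by
  simp only [star_sum, h.star_a]

/-- `1 - s = (1 - s)² + (s - s²)` for `s = ∑ a_i`, and `s - s² = ∑ (a_i - a_i²) ≥ 0`. -/
theorem one_sub_sum_mem (s : Finset ι) : 1 - ∑ i ∈ s, a i ∈ posCone Q := by
  have h1 := star_mul_self_mem_posCone (1 - ∑ i ∈ s, a i)
  have h2 := h.sum_sub_sq_mem s
  rw [Finset.sum_sub_distrib, ← h.sum_sq] at h2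
  rw [star_sub, star_one, h.star_sum_a] at h1
  convert add_mem h1 h2 using 1
  noncomm_ring

theorem star_glue (s : Finset ι) (k l : Fin d) :
    star (∑ i ∈ s, a i * e i k l) = ∑ i ∈ s, a i * e i l k := by
  rw [star_sum]
  refine Finset.sum_congr rfl fun i _ => ?_
  rw [star_mul, h.star_a, matrixUnit_star (h.unit i), h.comm]

theorem glue_mul (s : Finset ι) (k l m n : Fin d) :
    (∑ i ∈ s, a i * e i k l) * ∑ i ∈ s, a i * e i m n
      = if l = m then ∑ i ∈ s, a i * a i * e i k n else 0 := by
  rw [h.sum_mul_sum s (h.comm · k l)]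
  simp only [matrixUnit_mul (h.unit _)]
  split_ifs <;> simp

/-- `a² - a² e_ll = ((1 - e_ll) a)* ((1 - e_ll) a)`. -/
theorem sq_sub_mem (i : ι) (l : Fin d) : a i * a i - a i * a i * e i l l ∈ posCone Q := by
  have h1 := star_mul_self_mem_posCone ((1 - e i l l) * a i)
  have hp : e i l l * e i l l = e i l l := by simpa using matrixUnit_mul (h.unit i) l l l l
  have hq : (1 - e i l l) * (1 - e i l l) = 1 - e i l l := by
    simp [mul_sub, sub_mul, hp]
  rwa [star_mul, star_sub, star_one, h.star_a, matrixUnit_star (h.unit i), mul_assoc,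
    ← mul_assoc (1 - _), hq, sub_mul, one_mul, ← h.comm, mul_sub, ← mul_assoc] at h1

/-- The glued matrix units are contractions. -/
theorem one_sub_glue_mem (s : Finset ι) (k l : Fin d) :
    1 - star (∑ i ∈ s, a i * e i k l) * ∑ i ∈ s, a i * e i k l ∈ posCone Q := by
  rw [h.star_glue, h.glue_mul, if_pos rfl]
  have h1 : ∑ i ∈ s, (a i * a i - a i * a i * e i l l) ∈ posCone Q :=
    sum_mem fun i _ => h.sq_sub_mem i l
  have h2 := add_mem (add_mem (h.one_sub_sum_mem s) (h.sum_sub_sq_mem s)) h1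
  convert h2 using 1
  simp only [Finset.sum_sub_distrib]
  abel

variable {t : Q →+ ℝ} (ht : IsRealTrace t)

include ht

theorem trace_one_sub_sq_le (s : Finset ι) :
    t (star (1 - ∑ i ∈ s, a i) * (1 - ∑ i ∈ s, a i)) ≤ t (1 - ∑ i ∈ s, a i) := by
  have h2 := ht.nonneg_of_mem (h.sum_sub_sq_mem s)
  rw [Finset.sum_sub_distrib, ← h.sum_sq, map_sub] at h2
  have : star (1 - ∑ i ∈ s, a i) * (1 - ∑ i ∈ s, a i)
      = (1 - ∑ i ∈ s, a i) - (∑ i ∈ s, a i - (∑ i ∈ s, a i) * ∑ i ∈ s, a i) := by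
    rw [star_sub, star_one, h.star_sum_a]
    noncomm_ring
  rw [this, map_sub t (1 - _), map_sub t (∑ i ∈ s, a i)]
  linarith

/-- Over a part of the towers, the glued matrix units are at most as large as that part. -/
theorem trace_glue_le (s : Finset ι) (k l : Fin d) :
    t (star (∑ i ∈ s, a i * e i k l) * ∑ i ∈ s, a i * e i k l) ≤ ∑ i ∈ s, t (a i) := by
  rw [h.star_glue, h.glue_mul, if_pos rfl, map_sum]
  refine Finset.sum_le_sum fun i _ => ?_
  have h1 := ht.nonneg_of_mem (add_mem (sub_sq_mem_posCone (h.pos i) (h.pos' i)) (h.sq_sub_mem i l))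
  rw [sub_add_sub_cancel, map_sub] at h1
  linarith

/-- The glued family satisfies the matrix unit relations up to the size of the remainder of the
towers: its defects are `0`, `-(1 - s)` and `-(1 - s) ∑ a_i e_i`, where `s = ∑ a_i`. -/
theorem trace_matrixDefect_le (s : Finset ι) (r : MatrixRel d) :
    t (star (matrixDefect (fun k l => ∑ i ∈ s, a i * e i k l) r) *
      matrixDefect (fun k l => ∑ i ∈ s, a i * e i k l) r) ≤ t (1 - ∑ i ∈ s, a i) := by
  have hpos := ht.nonneg_of_mem (h.one_sub_sum_mem s)
  rcases r with ⟨k, l, m, n⟩ | ⟨k, l⟩ | _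
  · simp only [matrixDefect]
    rw [h.glue_mul]
    split_ifs with hlm
    · have e1 : ∑ i ∈ s, a i * a i * e i k n - ∑ i ∈ s, a i * e i k n
          = -((1 - ∑ i ∈ s, a i) * ∑ i ∈ s, a i * e i k n) := by
        have := h.sum_mul_sum s (x := 1) (y := fun i => e i k n) (by simp)
        simp only [Pi.one_apply, mul_one, one_mul] at this
        rw [sub_mul, this, one_mul, neg_sub]
      rw [e1, star_neg, neg_mul_neg]
      refine (ht.mul_le ?_ _).trans (h.trace_one_sub_sq_le ht _)
      simpa only [h.star_glue] using h.one_sub_glue_mem s n k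
    · simpa using hpos
  · simpa [matrixDefect, h.star_glue] using hpos
  · have e1 : ∑ k, ∑ i ∈ s, a i * e i k k - 1 = -(1 - ∑ i ∈ s, a i) := by
      rw [Finset.sum_comm]
      simp only [← Finset.mul_sum, matrixUnit_sum (h.unit _), mul_one]
      abel
    simp only [matrixDefect]
    rw [e1, star_neg, neg_mul_neg]
    exact h.trace_one_sub_sq_le ht _

end IsOrthogonalFamily

variable {G : Type*} [Group G]

open Classical in
theorem sum_filter_smul {M : Type*} [AddCommMonoid M] (S : Finset G) (k : G) (f : G → M) :
    ∑ g ∈ S with k * g ∈ S, f (k * g) = ∑ g ∈ S with k⁻¹ * g ∈ S, f g := by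
  refine Finset.sum_bij' (fun g _ => k * g) (fun g _ => k⁻¹ * g) ?_ ?_ ?_ ?_ ?_ <;>
    simp +contextual

open Classical in
/-- Translation by `k ∈ K` or by its inverse moves only a small part of a `(K, ε)`-invariant shape
out of the shape. -/
theorem card_filter_notMem_le {K : Finset G} {ε : ℝ} {S : Finset G} (hS : IsInvariantShape K ε S)
    {k : G} (hk : k ∈ K) :
    ((S.filter fun g => k⁻¹ * g ∉ S).card : ℝ) ≤ ε * S.card ∧
      ((S.filter fun g => k * g ∉ S).card : ℝ) ≤ ε * S.card := by
  have h1 : ((⋂ k ∈ insert 1 (K : Set G), k • (S : Set G)).ncard : ℝ)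
      ≤ ((S.filter fun g => k⁻¹ * g ∈ S).card : ℝ) := by
    rw [← Set.ncard_coe_finset]
    refine Nat.cast_le.2 (Set.ncard_le_ncard (fun g hg => ?_) (Finset.finite_toSet _))
    simp only [Set.mem_iInter] at hg
    have e1 := hg 1 (by simp)
    have e2 := hg k (by simp [hk])
    rw [Set.mem_smul_set_iff_inv_smul_mem] at e1 e2
    simpa using And.intro e1 e2
  have h2 : (S.filter fun g => k * g ∈ S).card = (S.filter fun g => k⁻¹ * g ∈ S).card := by
    simpa only [Finset.card_eq_sum_ones] using sum_filter_smul S k fun _ => 1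
  have h3 := S.card_filter_add_card_filter_not fun g => k⁻¹ * g ∈ S
  have h4 := S.card_filter_add_card_filter_not fun g => k * g ∈ S
  have h5 : (1 - ε) * (S.card : ℝ) ≤ _ := hS
  rw [← @Nat.cast_inj ℝ] at h3 h4 h2
  push_cast at h3 h4
  constructor <;> linarith

open Classical in
/-- Gluing translates of matrix units along approximately invariant equivariant towers yields
approximately invariant matrix units: the defect lives over the parts of the shapes that are moved
out of the shape, and an invariant trace is constant along each tower. -/
theorem trace_glue_sub_le [Algebra ℂ Q] {m d : ℕ} {β : G → Q →⋆ₐ[ℂ] Q}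
    (hβ : ∀ g h x, β (g * h) x = β g (β h x)) {K : Finset G} {ε : ℝ} {S : Fin m → Finset G}
    (hS : ∀ i, IsInvariantShape K ε (S i)) {a : (Σ _ : Fin m, G) → Q} {e : Fin d → Fin d → Q}
    (h : IsOrthogonalFamily a fun i k l => β i.2 (e k l))
    (hequi : ∀ i g, ∀ h ∈ S i, g * h ∈ S i → β g (a ⟨i, h⟩) = a ⟨i, g * h⟩)
    {t : Q →+ ℝ} (ht : IsRealTrace t) (h1 : t 1 = 1) (htβ : ∀ g x, t (β g x) = t x)
    (hε : 0 ≤ ε) {g : G} (hg : g ∈ K) (k l : Fin d) :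
    t (star (β g (∑ i ∈ Finset.univ.sigma S, a i * β i.2 (e k l))
        - ∑ i ∈ Finset.univ.sigma S, a i * β i.2 (e k l)) *
      (β g (∑ i ∈ Finset.univ.sigma S, a i * β i.2 (e k l))
        - ∑ i ∈ Finset.univ.sigma S, a i * β i.2 (e k l))) ≤ 4 * ε := by
  set P := ∑ i ∈ Finset.univ.sigma fun i => (S i).filter fun h => g * h ∉ S i,
    a i * β i.2 (e k l) with hP
  set P' := ∑ i ∈ Finset.univ.sigma fun i => (S i).filter fun h => g⁻¹ * h ∉ S i,
    a i * β i.2 (e k l) with hP'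
  have key : β g (∑ i ∈ Finset.univ.sigma S, a i * β i.2 (e k l))
        - ∑ i ∈ Finset.univ.sigma S, a i * β i.2 (e k l) = β g P - P' := by
    rw [hP, hP']
    simp only [Finset.sum_sigma, map_sum]
    rw [← Finset.sum_sub_distrib, ← Finset.sum_sub_distrib]
    refine Finset.sum_congr rfl fun i _ => ?_
    rw [← Finset.sum_filter_add_sum_filter_not (S i) (fun h => g * h ∈ S i)
        fun h => β g (a ⟨i, h⟩ * β h (e k l)),
      ← Finset.sum_filter_add_sum_filter_not (S i) (fun h => g⁻¹ * h ∈ S i)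
        fun h => a ⟨i, h⟩ * β h (e k l),
      ← sum_filter_smul (S i) g fun h => a ⟨i, h⟩ * β h (e k l)]
    have : ∑ h ∈ S i with g * h ∈ S i, β g (a ⟨i, h⟩ * β h (e k l))
        = ∑ h ∈ S i with g * h ∈ S i, a ⟨i, g * h⟩ * β (g * h) (e k l) := by
      refine Finset.sum_congr rfl fun h hh => ?_
      rw [Finset.mem_filter] at hh
      rw [map_mul, hequi i g h hh.1 hh.2, hβ]
    rw [this]
    abel
  have hconst : ∀ i, ∀ h ∈ S i, ∀ h' ∈ S i, t (a ⟨i, h⟩) = t (a ⟨i, h'⟩) := by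
    intro i h hh h' hh'
    have := hequi i (h' * h⁻¹) h hh (by simpa using hh')
    rw [inv_mul_cancel_right] at this
    rw [← this, htβ]
  have hsum : ∀ F : Fin m → Finset G, (∀ i, F i ⊆ S i) →
      (∀ i, ((F i).card : ℝ) ≤ ε * (S i).card) →
      ∑ i ∈ Finset.univ.sigma F, t (a i) ≤ ε := by
    intro F hF hc
    have h2 : ∑ i ∈ Finset.univ.sigma F, t (a i) ≤ ε * ∑ i ∈ Finset.univ.sigma S, t (a i) := by
      simp only [Finset.sum_sigma, Finset.mul_sum]
      refine Finset.sum_le_sum fun i _ => ?_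
      rcases (S i).eq_empty_or_nonempty with h0 | ⟨h₀, h0⟩
      · simp [h0, Finset.subset_empty.1 (h0 ▸ hF i)]
      · rw [Finset.sum_congr rfl fun h hh => hconst i h (hF i hh) h₀ h0, ← Finset.mul_sum,
          Finset.sum_congr rfl fun h hh => hconst i h hh h₀ h0]
        simp only [Finset.sum_const, nsmul_eq_mul]
        have := mul_le_mul_of_nonneg_right (hc i) (ht.nonneg_of_mem (h.pos ⟨i, h₀⟩))
        linarith
    have h3 := ht.nonneg_of_mem (h.one_sub_sum_mem (Finset.univ.sigma S))
    rw [map_sub, h1, map_sum] at h3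
    nlinarith
  rw [key]
  have h2 := ht.sub_le (β g P) P'
  rw [← map_star (β g), ← map_mul, htβ] at h2
  have h3 := (h.trace_glue_le ht _ k l).trans (hsum (fun i => (S i).filter fun h => g * h ∉ S i)
    (fun i => Finset.filter_subset _ _) fun i => (card_filter_notMem_le (hS i) hg).2)
  have h4 := (h.trace_glue_le ht _ k l).trans (hsum (fun i => (S i).filter fun h => g⁻¹ * h ∉ S i)
    (fun i => Finset.filter_subset _ _) fun i => (card_filter_notMem_le (hS i) hg).1)
  linarith

end Towers

/-! ### Quasi-invariant approximate units -/

section ApproximateUnit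

variable {D : Type*} [CStarAlgebra D] [PartialOrder D] [StarOrderedRing D]

theorem StarAlgEquiv.map_nonneg (β : D ≃⋆ₐ[ℂ] D) {x : D} (hx : 0 ≤ x) : 0 ≤ β x := by
  obtain ⟨y, rfl⟩ := CStarAlgebra.nonneg_iff_eq_star_mul_self.1 hx
  rw [map_mul, map_star]
  exact star_mul_self_nonneg _

theorem StarAlgEquiv.map_le_map (β : D ≃⋆ₐ[ℂ] D) {x y : D} (h : x ≤ y) : β x ≤ β y := by
  rw [← sub_nonneg, ← map_sub]
  exact β.map_nonneg (sub_nonneg.2 h)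

theorem StarAlgEquiv.map_real_smul (β : D ≃⋆ₐ[ℂ] D) (c : ℝ) (x : D) : β (c • x) = c • β x := by
  rw [← Complex.coe_smul, ← Complex.coe_smul, map_smul]

theorem StarAlgEquiv.map_sqrt (β : D ≃⋆ₐ[ℂ] D) {x : D} (hx : 0 ≤ x) :
    β (CFC.sqrt x) = CFC.sqrt (β x) := by
  refine (CFC.sqrt_unique ?_ (β.map_nonneg (CFC.sqrt_nonneg x))).symm
  rw [← map_mul, CFC.sqrt_mul_sqrt_self x hx]

theorem norm_le_of_neg_le_of_le {x : D} {c : ℝ} (h1 : -(c • (1 : D)) ≤ x) (h2 : x ≤ c • (1 : D))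
    (hc : 0 ≤ c) : ‖x‖ ≤ c := by
  have hp : 0 ≤ c • (1 : D) - x := sub_nonneg.2 h2
  have hs : IsSelfAdjoint x := by
    have h3 := (IsSelfAdjoint.all c).smul (IsSelfAdjoint.one D)
    simpa using h3.sub (IsSelfAdjoint.of_nonneg hp)
  obtain (h | _) := subsingleton_or_nontrivial D
  · simpa [Subsingleton.elim x 0] using hc
  rw [← Algebra.algebraMap_eq_smul_one] at h1 h2
  rw [← map_neg] at h1
  rw [algebraMap_le_iff_le_spectrum] at h1
  rw [le_algebraMap_iff_spectrum_le] at h2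
  have h4 := norm_cfc_le (f := fun t : ℝ => t) (a := x) hc fun t ht => abs_le.2 ⟨h1 t ht, h2 t ht⟩
  rwa [cfc_id' ℝ x] at h4

theorem CFC.sqrt_real_smul {c : ℝ} (hc : 0 ≤ c) {x : D} (hx : 0 ≤ x) :
    CFC.sqrt (c • x) = √c • CFC.sqrt x := by
  refine CFC.sqrt_unique ?_ (smul_nonneg (Real.sqrt_nonneg c) (CFC.sqrt_nonneg x))
  rw [smul_mul_smul_comm, Real.mul_self_sqrt hc, CFC.sqrt_mul_sqrt_self x hx]

variable {ι : Type*} [Fintype ι] (β : ι → D ≃⋆ₐ[ℂ] D)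

/-- An ideal that is invariant under finitely many automorphisms contains, above any of its
positive elements, a positive element `b` that each of these automorphisms increases at most by a
constant factor: `b = ∑ Sᵏ b₀` where `S` is a small multiple of the sum of the automorphisms and
their inverses. -/
theorem exists_quasi_invariant {I : Ideal D} (hI : IsClosed (I : Set D))
    (hβ : ∀ i, ∀ x ∈ I, β i x ∈ I ∧ (β i).symm x ∈ I) {b₀ : D} (hb₀ : 0 ≤ b₀) (hbI : b₀ ∈ I) :
    ∃ b ∈ I, b₀ ≤ b ∧ ∃ C : ℝ, 1 ≤ C ∧ ∀ i, β i b ≤ C • b ∧ (β i).symm b ≤ C • b := by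
  let T : D →ₗ[ℂ] D := ∑ i, ((β i : D →ₐ[ℂ] D).toLinearMap + ((β i).symm : D →ₐ[ℂ] D).toLinearMap)
  have hT : ∀ x, T x = ∑ i, (β i x + (β i).symm x) := fun x => by
    simp only [T, LinearMap.sum_apply, LinearMap.add_apply]
    rfl
  set N : ℝ := 2 * Fintype.card ι with hN
  have hN0 : 0 ≤ N := by positivity
  have hTn : ∀ x, ‖T x‖ ≤ N * ‖x‖ := fun x => by
    rw [hT]
    refine (norm_sum_le_of_le (f := fun i => β i x + (β i).symm x) _
      (fun i _ => (norm_add_le _ _).trans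
      (by rw [StarAlgEquiv.norm_map, StarAlgEquiv.norm_map]))).trans ?_
    simp only [Finset.sum_const, Finset.card_univ, nsmul_eq_mul, hN]
    linarith
  have hTpos : ∀ x, 0 ≤ x → 0 ≤ T x := fun x hx => by
    rw [hT]
    exact Finset.sum_nonneg fun i _ => add_nonneg ((β i).map_nonneg hx) ((β i).symm.map_nonneg hx)
  have hTI : ∀ x ∈ I, T x ∈ I := fun x hx => by
    rw [hT]
    exact sum_mem fun i _ => add_mem (hβ i x hx).1 (hβ i x hx).2
  -- Any `c` with `c N < 1` makes the Neumann series converge.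
  set c : ℝ := (2 * (N + 1))⁻¹ with hc
  have hc0 : 0 < c := by positivity
  let S : D →L[ℂ] D := (c : ℂ) • T.mkContinuous N hTn
  have hS : ∀ x, S x = c • T x := fun x => by
    rw [← Complex.coe_smul]
    rfl
  have hSn : ‖S‖ < 1 := by
    have h0 : ‖S‖ ≤ c * N := S.opNorm_le_bound (by positivity) fun x => by
      rw [hS, norm_smul, Real.norm_of_nonneg hc0.le, mul_assoc]
      exact mul_le_mul_of_nonneg_left (hTn x) hc0.le
    refine h0.trans_lt ?_
    rw [hc, inv_mul_lt_iff₀ (by positivity)]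
    linarith
  have hpos : ∀ k, 0 ≤ (S ^ k) b₀ ∧ (S ^ k) b₀ ∈ I := fun k => by
    induction k with
    | zero => exact ⟨hb₀, hbI⟩
    | succ k ih =>
      rw [pow_succ', mul_apply_eq_comp, hS]
      refine ⟨smul_nonneg hc0.le (hTpos _ ih.1), ?_⟩
      rw [← Complex.coe_smul]
      exact Submodule.smul_of_tower_mem I _ (hTI _ ih.2)
  have hsum : Summable fun k => (S ^ k) b₀ := by
    refine Summable.of_norm_bounded (g := fun k => ‖S‖ ^ k * ‖b₀‖)
      ((summable_geometric_of_lt_one (norm_nonneg _) hSn).mul_right _) fun k => ?_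
    induction k with
    | zero => simp
    | succ k ih =>
      rw [pow_succ', mul_apply_eq_comp, pow_succ', mul_assoc]
      exact (S.le_opNorm _).trans (mul_le_mul_of_nonneg_left ih (norm_nonneg _))
  set b := ∑' k, (S ^ k) b₀ with hb
  have hb0 : 0 ≤ b := tsum_nonneg fun k => (hpos k).1
  have hbI : b ∈ I := hI.mem_of_tendsto hsum.hasSum
    (Eventually.of_forall fun s => sum_mem fun k _ => (hpos k).2)
  have hfix : b = b₀ + c • T b := by
    rw [← hS, hb, S.map_tsum hsum, hsum.tsum_eq_zero_add]
    simp only [pow_succ', mul_apply_eq_comp, pow_zero, one_apply_eq_self]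
  have hcT : c • T b ≤ b := by
    conv_rhs => rw [hfix]
    exact le_add_of_nonneg_left hb₀
  have hTb : T b ≤ c⁻¹ • b := by
    have := smul_le_smul_of_nonneg_left hcT (inv_nonneg.2 hc0.le)
    rwa [smul_smul, inv_mul_cancel₀ hc0.ne', one_smul] at this
  refine ⟨b, hbI, ?_, c⁻¹, ?_, fun i => ?_⟩
  · conv_rhs => rw [hfix]
    exact le_add_of_nonneg_right (smul_nonneg hc0.le (hTpos b hb0))
  · rw [hc, inv_inv]
    linarith
  · have h1 : β i b + (β i).symm b ≤ T b := by
      rw [hT]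
      exact Finset.single_le_sum (f := fun i => β i b + (β i).symm b)
        (fun i _ => add_nonneg ((β i).map_nonneg hb0) ((β i).symm.map_nonneg hb0))
        (Finset.mem_univ i)
    exact ⟨((le_add_of_nonneg_right ((β i).symm.map_nonneg hb0)).trans h1).trans hTb,
      ((le_add_of_nonneg_left ((β i).map_nonneg hb0)).trans h1).trans hTb⟩

theorem mul_one_sub_pow_le {t : ℝ} (h0 : 0 ≤ t) (h1 : t ≤ 1) (n : ℕ) :
    (1 - t) * t ^ n * (1 - t) ≤ 1 / (n + 1) := by
  have hgeom : (1 - t) * ∑ i ∈ Finset.range (n + 1), t ^ i = 1 - t ^ (n + 1) := by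
    have := geom_sum_mul t (n + 1)
    linarith
  have h2 : (n + 1 : ℝ) * t ^ n ≤ ∑ i ∈ Finset.range (n + 1), t ^ i := by
    have : ∑ i ∈ Finset.range (n + 1), t ^ n ≤ ∑ i ∈ Finset.range (n + 1), t ^ i :=
      Finset.sum_le_sum fun i hi =>
        pow_le_pow_of_le_one h0 h1 (Nat.lt_succ_iff.1 (Finset.mem_range.1 hi))
    simpa using this
  have h3 : (n + 1 : ℝ) * ((1 - t) * t ^ n) ≤ 1 := by
    have h4 := mul_le_mul_of_nonneg_left h2 (sub_nonneg.2 h1)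
    have h5 : 0 ≤ t ^ (n + 1) := by positivity
    linarith
  have hn : (0 : ℝ) < n + 1 := by positivity
  rw [le_div_iff₀ hn]
  have h6 : 0 ≤ (1 - t) * t ^ n := mul_nonneg (sub_nonneg.2 h1) (by positivity)
  nlinarith

theorem norm_one_sub_mul_pow_mul_le {x : D} (h0 : 0 ≤ x) (h1 : x ≤ 1) (n : ℕ) :
    ‖(1 - x) * x ^ n * (1 - x)‖ ≤ 1 / (n + 1) := by
  have e : (1 - x) * x ^ n * (1 - x) = cfc (fun t : ℝ => (1 - t) * t ^ n * (1 - t)) x := by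
    rw [cfc_mul .., cfc_mul .., cfc_pow .., cfc_sub .., cfc_id' ℝ x, cfc_const_one ℝ x]
  rw [e]
  refine norm_cfc_le (by positivity) fun t ht => ?_
  have h0' : 0 ≤ t := spectrum_nonneg_of_nonneg h0 ht
  have h1' : t ≤ 1 := by
    rw [← map_one (algebraMap ℝ D), le_algebraMap_iff_spectrum_le] at h1
    exact h1 t ht
  rw [Real.norm_of_nonneg (mul_nonneg (mul_nonneg (sub_nonneg.2 h1') (by positivity))
    (sub_nonneg.2 h1'))]
  exact mul_one_sub_pow_le h0' h1' n

/-- **Quasi-invariant approximate units.** A closed ideal that is stable under square roots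
of positive elements and under finitely many automorphisms contains a positive contraction that
acts almost as a unit on finitely many given elements and is almost fixed by the automorphisms.
If `β b ≤ C b`, then operator monotonicity of the square root yields `β h ≤ C^(2⁻ᵏ) h` for
`h = b^(2⁻ᵏ)`, where `C^(2⁻ᵏ) → 1`. -/
theorem exists_quasi_invariant_approximate_unit {I : Ideal D} [I.IsTwoSided]
    (hI : IsClosed (I : Set D)) (hsqrt : ∀ x ∈ I, 0 ≤ x → CFC.sqrt x ∈ I)
    (hβ : ∀ i, ∀ x ∈ I, β i x ∈ I ∧ (β i).symm x ∈ I) {κ : Type*} (s : Finset κ) (j : κ → D)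
    (hj : ∀ r ∈ s, j r ∈ I) {δ : ℝ} (hδ : 0 < δ) :
    ∃ h ∈ I, 0 ≤ h ∧ h ≤ 1 ∧ (∀ r ∈ s, ‖(1 - h) * j r‖ ≤ δ) ∧ ∀ i, ‖β i h - h‖ ≤ δ := by
  obtain ⟨b, hbI, hb₀, C, hC, hCb⟩ := exists_quasi_invariant β hI hβ
    (b₀ := ∑ r ∈ s, j r * star (j r)) (Finset.sum_nonneg fun r _ => mul_star_self_nonneg _)
    (sum_mem fun r hr => I.mul_mem_right _ (hj r hr))
  have hb : 0 ≤ b := (Finset.sum_nonneg fun r _ => mul_star_self_nonneg _).trans hb₀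
  set R : ℝ := ‖b‖ + 1 with hR
  have hR0 : 0 < R := by positivity
  set y : D := R⁻¹ • b with hy
  have hy0 : 0 ≤ y := smul_nonneg (inv_nonneg.2 hR0.le) hb
  have hy1 : y ≤ 1 := by
    rw [← CStarAlgebra.norm_le_one_iff_of_nonneg y, hy, norm_smul,
      Real.norm_of_nonneg (by positivity), inv_mul_le_iff₀ hR0]
    linarith
  have hyI : y ∈ I := by
    rw [hy, ← Complex.coe_smul]
    exact Submodule.smul_of_tower_mem I _ hbI
  have hyj : ∀ r ∈ s, j r * star (j r) ≤ R • y := fun r hr => by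
    rw [hy, smul_smul, mul_inv_cancel₀ hR0.ne', one_smul]
    exact (Finset.single_le_sum (f := fun r => j r * star (j r))
      (fun r _ => mul_star_self_nonneg _) hr).trans hb₀
  have hyC : ∀ i, β i y ≤ C • y ∧ (β i).symm y ≤ C • y := fun i => by
    rw [hy, StarAlgEquiv.map_real_smul, StarAlgEquiv.map_real_smul, smul_comm C]
    exact ⟨smul_le_smul_of_nonneg_left (hCb i).1 (by positivity),
      smul_le_smul_of_nonneg_left (hCb i).2 (by positivity)⟩
  have hroot : ∀ k : ℕ, ∃ h ∈ I, 0 ≤ h ∧ h ≤ 1 ∧ h ^ (2 ^ k) = y ∧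
      ∀ i, β i h ≤ (1 + (C - 1) / 2 ^ k) • h ∧ (β i).symm h ≤ (1 + (C - 1) / 2 ^ k) • h := by
    intro k
    induction k with
    | zero => exact ⟨y, hyI, hy0, hy1, by simp, by simpa using hyC⟩
    | succ k ih =>
      obtain ⟨h, hhI, h0, h1, hp, hh⟩ := ih
      have hd : 0 ≤ (C - 1) / 2 ^ k := div_nonneg (by linarith) (by positivity)
      have hs : √(1 + (C - 1) / 2 ^ k) ≤ 1 + (C - 1) / 2 ^ (k + 1) := by
        have : (C - 1) / 2 ^ (k + 1) = (C - 1) / 2 ^ k / 2 := by rw [div_div, pow_succ]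
        rw [Real.sqrt_le_left (by positivity), this]
        nlinarith
      have hq : ∀ γ : D ≃⋆ₐ[ℂ] D, γ h ≤ (1 + (C - 1) / 2 ^ k) • h →
          γ (CFC.sqrt h) ≤ (1 + (C - 1) / 2 ^ (k + 1)) • CFC.sqrt h := fun γ hγ => by
        rw [γ.map_sqrt h0]
        refine (CFC.sqrt_le_sqrt _ _ hγ).trans ?_
        rw [CFC.sqrt_real_smul (by positivity) h0]
        exact smul_le_smul_of_nonneg_right hs (CFC.sqrt_nonneg h)
      refine ⟨CFC.sqrt h, hsqrt h hhI h0, CFC.sqrt_nonneg h, ?_, ?_,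
        fun i => ⟨hq _ (hh i).1, hq _ (hh i).2⟩⟩
      · have := CFC.sqrt_le_sqrt _ _ h1
        rwa [CFC.sqrt_one] at this
      · rw [pow_succ', pow_mul, sq, CFC.sqrt_mul_sqrt_self h h0, hp]
  have hlim1 : Tendsto (fun k : ℕ => (C - 1) / 2 ^ k) atTop (𝓝 0) :=
    tendsto_const_nhds.div_atTop (tendsto_pow_atTop_atTop_of_one_lt one_lt_two)
  have hlim2 : Tendsto (fun k : ℕ => R * (1 / ((2 ^ k : ℕ) + 1 : ℝ))) atTop (𝓝 0) := by
    have := (tendsto_one_div_add_atTop_nhds_zero_nat (𝕜 := ℝ)).comp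
      (tendsto_pow_atTop_atTop_of_one_lt (r := 2) one_lt_two)
    simpa using this.const_mul R
  obtain ⟨k, hk1, hk2⟩ := ((hlim1.eventually_lt_const hδ).and
    (hlim2.eventually_lt_const (pow_pos hδ 2))).exists
  obtain ⟨h, hhI, h0, h1, hp, hh⟩ := hroot k
  have hd : 0 ≤ (C - 1) / 2 ^ k := div_nonneg (by linarith) (by positivity)
  have hsa : star (1 - h) = 1 - h := by
    rw [star_sub, star_one, (IsSelfAdjoint.of_nonneg h0).star_eq]
  refine ⟨h, hhI, h0, h1, fun r hr => ?_, fun i => ?_⟩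
  · have h2 : ‖(1 - h) * j r‖ ^ 2 ≤ R * (1 / ((2 ^ k : ℕ) + 1 : ℝ)) := by
      have e : (1 - h) * j r * star ((1 - h) * j r)
          = (1 - h) * (j r * star (j r)) * star (1 - h) := by
        simp only [star_mul, mul_assoc]
      rw [sq, ← CStarRing.norm_self_mul_star, e]
      refine (CStarAlgebra.norm_le_norm_of_nonneg_of_le (by
        rw [← e]; exact mul_star_self_nonneg _)
        (star_right_conjugate_le_conjugate (hyj r hr) (1 - h))).trans ?_
      rw [mul_smul_comm, smul_mul_assoc, norm_smul, Real.norm_of_nonneg hR0.le, hsa, ← hp]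
      exact mul_le_mul_of_nonneg_left (norm_one_sub_mul_pow_mul_le h0 h1 _) hR0.le
    exact le_of_sq_le_sq (h2.trans hk2.le) hδ.le
  · refine (norm_le_of_neg_le_of_le ?_ ?_ hd).trans hk1.le
    · have h2 := (β i).map_le_map (hh i).2
      have h3 : β i ((β i).symm h) = h := (β i).apply_symm_apply h
      rw [h3, StarAlgEquiv.map_real_smul, add_smul, one_smul] at h2
      have h4 : ((C - 1) / 2 ^ k) • β i h ≤ ((C - 1) / 2 ^ k) • (1 : D) := by
        refine smul_le_smul_of_nonneg_left ?_ hd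
        simpa using (β i).map_le_map h1
      have h5 : h ≤ β i h + ((C - 1) / 2 ^ k) • (1 : D) := h2.trans (by gcongr)
      rw [neg_le_sub_iff_le_add]
      exact h5
    · have h2 := (hh i).1
      rw [add_smul, one_smul] at h2
      rw [sub_le_iff_le_add']
      exact h2.trans (by gcongr)

end ApproximateUnit

/-! ### Tracially null sequences -/

section TraceNull

variable {A : Type*} [CStarAlgebra A] (U : Ultrafilter ℕ) (T : Set (TracialState A))

theorem norm2Sup_add_le (a b : A) :
    norm2Sup T (a + b) ≤ 2 * (norm2Sup T a + norm2Sup T b) := by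
  have ha := norm2Sup_nonneg T a
  have hb := norm2Sup_nonneg T b
  refine norm2Sup_le T (by positivity) fun τ hτ => (τ.norm2_add_le a b).trans ?_
  have := le_norm2Sup T hτ a
  have := le_norm2Sup T hτ b
  linarith

/-- The class of a bounded sequence in `A_U / J_T`. For `T = T(A)` this is `tracialClass`. -/
abbrev traceClass : EllInfty A →⋆ₐ[ℂ] NormUltrapower U A ⧸ traceIdeal U T :=
  (quotientMk (traceIdeal U T)).comp (normClass U)

/-- The ideal of bounded sequences with `lim_{n → U} ‖a_n‖_{2,T} = 0`. -/
abbrev traceNull : Ideal (EllInfty A) := RingHom.ker (traceClass U T)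

theorem mem_traceNull {a : EllInfty A} :
    a ∈ traceNull U T ↔ Tendsto (fun n => norm2Sup T (a n)) U (𝓝 0) := by
  rw [← normClass_mem_traceIdeal, RingHom.mem_ker]
  exact Ideal.Quotient.eq_zero_iff_mem

theorem isClosed_traceNull : IsClosed (traceNull U T : Set (EllInfty A)) := by
  refine isClosed_of_closure_subset fun x hx => ?_
  rw [SetLike.mem_coe, mem_traceNull, Metric.tendsto_nhds]
  intro ε hε
  obtain ⟨y, hy, hxy⟩ := Metric.mem_closure_iff.1 hx (ε / 4) (by positivity)
  rw [SetLike.mem_coe, mem_traceNull] at hy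
  filter_upwards [hy.eventually_lt_const (show 0 < ε / 4 by positivity)] with n hn
  rw [Real.dist_0_eq_abs, abs_of_nonneg (norm2Sup_nonneg T _)]
  have h1 := norm2Sup_add_le T (x n - y n) (y n)
  have h2 : norm2Sup T (x n - y n) ≤ dist x y :=
    (norm2Sup_le_norm T _).trans (by rw [dist_eq_norm]; exact (x - y).norm_coe_le_norm n)
  rw [sub_add_cancel] at h1
  linarith

theorem isClosed_cIdeal : IsClosed (cIdeal U A : Set (EllInfty A)) := by
  refine isClosed_of_closure_subset fun x hx => ?_
  rw [SetLike.mem_coe, mem_cIdeal, Metric.tendsto_nhds]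
  intro ε hε
  obtain ⟨y, hy, hxy⟩ := Metric.mem_closure_iff.1 hx (ε / 2) (by positivity)
  rw [SetLike.mem_coe, mem_cIdeal] at hy
  filter_upwards [hy.eventually_lt_const (show 0 < ε / 2 by positivity)] with n hn
  rw [Real.dist_0_eq_abs, abs_of_nonneg (norm_nonneg _)]
  have h1 := norm_add_le (x n - y n) (y n)
  have h2 : ‖x n - y n‖ ≤ dist x y := by
    rw [dist_eq_norm]; exact (x - y).norm_coe_le_norm n
  rw [sub_add_cancel] at h1
  linarith

/-- If `x = y²` is tracially null and `y` is self-adjoint, then so is `y`, because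
`‖y‖_{2,τ}² = τ(x) ≤ ‖x‖_{2,τ}`. -/
theorem mem_traceNull_of_mul_self {x y : EllInfty A} (hx : x ∈ traceNull U T) (hy : star y = y)
    (hyx : y * y = x) : y ∈ traceNull U T := by
  rw [mem_traceNull] at hx ⊢
  have hx' : Tendsto (fun n => √(norm2Sup T (x n))) U (𝓝 0) := by
    simpa [Function.comp_def] using (Real.continuous_sqrt.tendsto 0).comp hx
  refine squeeze_zero (fun _ => norm2Sup_nonneg T _) (fun n => ?_) hx'
  refine norm2Sup_le T (Real.sqrt_nonneg _) fun τ hτ => Real.sqrt_le_sqrt ?_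
  have hn : star (y n) = y n := congrArg (fun z : EllInfty A => z n) hy
  have hn' : y n * y n = x n := congrArg (fun z : EllInfty A => z n) hyx
  rw [hn, hn']
  exact (Complex.re_le_norm _).trans ((τ.norm_apply_le_norm2 _).trans (le_norm2Sup T hτ _))

/-- A star automorphism of `A` applied to the entries of bounded sequences, as an automorphism. -/
def ellInftyAut (φ : A ≃⋆ₐ[ℂ] A) : EllInfty A ≃⋆ₐ[ℂ] EllInfty A :=
  { ellInftyMap φ with
    invFun := ellInftyMap φ.symm
    left_inv := fun x => by ext n; exact φ.symm_apply_apply (x n)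
    right_inv := fun x => by ext n; exact φ.apply_symm_apply (x n)
    map_smul' := fun c x => map_smul (ellInftyMap φ) c x }

theorem ellInftyAut_apply (φ : A ≃⋆ₐ[ℂ] A) (x : EllInfty A) (n : ℕ) :
    ellInftyAut φ x n = φ (x n) := rfl

theorem ellInftyAut_symm_apply (φ : A ≃⋆ₐ[ℂ] A) (x : EllInfty A) (n : ℕ) :
    (ellInftyAut φ).symm x n = φ.symm (x n) := rfl

variable {T} in
theorem norm2Sup_map_of_fixed {φ : A ≃⋆ₐ[ℂ] A} (h : ∀ τ ∈ T, ∀ a, τ (φ a) = τ a) (a : A) :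
    norm2Sup T (φ a) = norm2Sup T a := by
  unfold norm2Sup
  congr 1
  funext τ
  unfold TracialState.norm2
  rw [← map_star, ← map_mul, h τ.1 τ.2]

variable {T} in
theorem ellInftyAut_mem_traceNull {φ : A ≃⋆ₐ[ℂ] A} (h : ∀ τ ∈ T, ∀ a, τ (φ a) = τ a)
    {x : EllInfty A} (hx : x ∈ traceNull U T) :
    ellInftyAut φ x ∈ traceNull U T ∧ (ellInftyAut φ).symm x ∈ traceNull U T := by
  have h' : ∀ τ ∈ T, ∀ a, τ (φ.symm a) = τ a := fun τ hτ a => by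
    rw [← h τ hτ, φ.apply_symm_apply]
  simp only [mem_traceNull, ellInftyAut_apply, ellInftyAut_symm_apply, norm2Sup_map_of_fixed h,
    norm2Sup_map_of_fixed h'] at hx ⊢
  exact ⟨hx, hx⟩

/-- Quasi-invariant approximate units in the ideal of tracially null sequences. -/
theorem exists_approximate_unit_traceNull {ι : Type*} [Fintype ι] (φ : ι → A ≃⋆ₐ[ℂ] A)
    (hφ : ∀ i, ∀ τ ∈ T, ∀ a, τ (φ i a) = τ a) {κ : Type*} (s : Finset κ) (j : κ → EllInfty A)
    (hj : ∀ r ∈ s, j r ∈ traceNull U T) {δ : ℝ} (hδ : 0 < δ) :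
    ∃ h ∈ traceNull U T, star h = h ∧ ‖1 - h‖ ≤ 1 ∧ (∀ r ∈ s, ‖(1 - h) * j r‖ ≤ δ) ∧
      ∀ i, ‖ellInftyAut (φ i) h - h‖ ≤ δ := by
  let _ : PartialOrder (EllInfty A) := CStarAlgebra.spectralOrder _
  let _ : StarOrderedRing (EllInfty A) := CStarAlgebra.spectralOrderedRing _
  obtain ⟨h, hI, h0, h1, h2, h3⟩ := exists_quasi_invariant_approximate_unit
    (fun i => ellInftyAut (φ i)) (isClosed_traceNull U T)
    (fun x hx hx0 => mem_traceNull_of_mul_self U T hx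
      (IsSelfAdjoint.of_nonneg (CFC.sqrt_nonneg x)).star_eq (CFC.sqrt_mul_sqrt_self x hx0))
    (fun i x hx => ellInftyAut_mem_traceNull U (hφ i) hx) s j hj hδ
  refine ⟨h, hI, (IsSelfAdjoint.of_nonneg h0).star_eq, ?_, h2, h3⟩
  rw [CStarAlgebra.norm_le_one_iff_of_nonneg _ (sub_nonneg.2 h1)]
  exact sub_le_self _ h0

theorem exists_nonneg_lift [PartialOrder (EllInfty A)] [StarOrderedRing (EllInfty A)]
    {x : NormUltrapower U A ⧸ traceIdeal U T} (hx : x ∈ posCone _) :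
    ∃ p : EllInfty A, 0 ≤ p ∧ traceClass U T p = x := by
  induction hx using AddSubmonoid.closure_induction with
  | mem x hx =>
    obtain ⟨w, rfl⟩ := hx
    obtain ⟨w, rfl⟩ := Ideal.Quotient.mk_surjective w
    obtain ⟨w, rfl⟩ := normClass_surjective U w
    refine ⟨star w * w, star_mul_self_nonneg w, ?_⟩
    rw [map_mul, map_star]
    rfl
  | zero => exact ⟨0, le_rfl, map_zero _⟩
  | add x y _ _ hx hy =>
    obtain ⟨p, hp, rfl⟩ := hx
    obtain ⟨q, hq, rfl⟩ := hy
    exact ⟨p + q, add_nonneg hp hq, map_add _ _ _⟩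

/-- An algebraic contraction in `A_U / J_T` has a representing sequence of norm at most `2`: if
`y* y ≤ 1 + j` with `j` tracially null and `h` is an approximate unit for `j`, then
`‖y (1 - h)‖² ≤ 1 + ‖(1 - h) j‖`. -/
theorem exists_bounded_lift {x : NormUltrapower U A ⧸ traceIdeal U T}
    (hx : 1 - star x * x ∈ posCone _) : ∃ y : EllInfty A, ‖y‖ ≤ 2 ∧ traceClass U T y = x := by
  let _ : PartialOrder (EllInfty A) := CStarAlgebra.spectralOrder _
  let _ : StarOrderedRing (EllInfty A) := CStarAlgebra.spectralOrderedRing _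
  obtain ⟨p, hp, hpx⟩ := exists_nonneg_lift U T hx
  obtain ⟨y, hy⟩ : ∃ y, traceClass U T y = x := by
    obtain ⟨x, rfl⟩ := Ideal.Quotient.mk_surjective x
    obtain ⟨x, rfl⟩ := normClass_surjective U x
    exact ⟨x, rfl⟩
  set j : EllInfty A := star y * y + p - 1 with hj
  have hjI : j ∈ traceNull U T := by
    rw [RingHom.mem_ker, hj, map_sub, map_add, map_mul, map_star, map_one, hpx, hy]
    abel
  obtain ⟨h, hI, hs, h1, h2, -⟩ := exists_approximate_unit_traceNull U T
    (ι := Empty) (fun i => i.elim) (fun i => i.elim) {()} (fun _ => j) (fun _ _ => hjI) one_pos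
  refine ⟨y * (1 - h), ?_, ?_⟩
  · have hsa : star (1 - h) = 1 - h := by rw [star_sub, star_one, hs]
    have e : star (y * (1 - h)) * (y * (1 - h))
        = (1 - h) * (1 - h) + (1 - h) * j * (1 - h) - (1 - h) * p * (1 - h) := by
      rw [star_mul, hsa, hj]
      noncomm_ring
    have hle : star (y * (1 - h)) * (y * (1 - h))
        ≤ (1 - h) * (1 - h) + (1 - h) * j * (1 - h) := by
      rw [e]
      refine sub_le_self _ ?_
      have := star_left_conjugate_nonneg hp (1 - h)
      rwa [hsa] at this
    have hn := CStarAlgebra.norm_le_norm_of_nonneg_of_le (star_mul_self_nonneg _) hle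
    rw [CStarRing.norm_star_mul_self] at hn
    have h3 : ‖(1 - h) * (1 - h)‖ ≤ 1 :=
      (norm_mul_le _ _).trans (mul_le_one₀ h1 (norm_nonneg _) h1)
    have h4 : ‖(1 - h) * j * (1 - h)‖ ≤ 1 :=
      (norm_mul_le _ _).trans (mul_le_one₀ (h2 () (by simp)) (norm_nonneg _) h1)
    have h5 := norm_add_le ((1 - h) * (1 - h)) ((1 - h) * j * (1 - h))
    nlinarith [norm_nonneg (y * (1 - h))]
  · rw [map_mul, map_sub, map_one, RingHom.mem_ker.1 hI, sub_zero, mul_one, hy]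

end TraceNull

/-! ### Diagonal sequences -/

section Diagonal

variable {A : Type*} [CStarAlgebra A] (U : Ultrafilter ℕ)

/-- Diagonal sequences: `f n j` measures the failure of the `j`-th of countably many conditions on
the `n`-th entries. If any finitely many of them can be met along `U` up to any error, with a uniform
bound in norm, then one bounded sequence meets all of them in the limit. -/
theorem exists_diagonal {ι κ : Type*} [Countable κ] {C : ℝ} (hC : 0 ≤ C)
    (f : ℕ → κ → (ι → A) → ℝ) (hf : ∀ n j x, 0 ≤ f n j x)
    (H : ∀ n (s : Finset κ) (ε : ℝ), 0 < ε → ∃ x : ι → EllInfty A, (∀ i, ‖x i‖ ≤ C) ∧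
      ∀ j ∈ s, ∀ᶠ m in U, f n j (fun i => x i m) < ε) :
    ∃ x : ι → EllInfty A, (∀ i, ‖x i‖ ≤ C) ∧
      ∀ j, Tendsto (fun n => f n j fun i => x i n) atTop (𝓝 0) := by
  obtain ⟨enc, henc⟩ := exists_injective_nat κ
  have hfin : ∀ n, {j | enc j ≤ n}.Finite := fun n =>
    (Set.finite_Iic n).preimage henc.injOn
  have H' : ∀ n : ℕ, ∃ x : ι → A, (∀ i, ‖x i‖ ≤ C) ∧
      ∀ j, enc j ≤ n → f n j x < 1 / ((n : ℝ) + 1) := by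
    intro n
    obtain ⟨x, hx, h⟩ := H n (hfin n).toFinset (1 / ((n : ℝ) + 1)) (by positivity)
    have h' := (Filter.eventually_all_finset _).2 h
    obtain ⟨m, hm⟩ := h'.exists
    exact ⟨fun i => x i m, fun i => ((x i).norm_coe_le_norm m).trans (hx i),
      fun j hj => hm j (by simpa using hj)⟩
  choose x hx h using H'
  refine ⟨fun i => BoundedContinuousFunction.ofNormedAddCommGroup (fun n => x n i)
    continuous_of_discreteTopology C fun n => hx n i, fun i =>
    BoundedContinuousFunction.norm_ofNormedAddCommGroup_le _ hC _, fun j => ?_⟩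
  refine squeeze_zero' (Eventually.of_forall fun n => hf _ _ _) ?_
    (tendsto_one_div_add_atTop_nhds_zero_nat (𝕜 := ℝ))
  filter_upwards [eventually_ge_atTop (enc j)] with n hn
  exact (h n j hn).le

end Diagonal

/-! ### Limit traces -/

section LimitTrace

variable {A : Type*} [CStarAlgebra A] (U : Ultrafilter ℕ)

/-- The real part of a limit trace. -/
def reLimitTrace (τ : ℕ → TracialState A) : TracialUltrapower U A →+ ℝ where
  toFun x := (limitTrace U τ x).re
  map_zero' := by
    have h := tendsto_limitTrace U τ 0
    rw [map_zero] at h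
    rw [tendsto_nhds_unique h (b := 0) (tendsto_const_nhds.congr fun n =>
      (map_zero (τ n).toLinearMap).symm)]
    rfl
  map_add' x y := by
    obtain ⟨x, rfl⟩ := tracialClass_surjective U x
    obtain ⟨y, rfl⟩ := tracialClass_surjective U y
    have h := (tendsto_limitTrace U τ x).add (tendsto_limitTrace U τ y)
    have h' := tendsto_limitTrace U τ (x + y)
    rw [map_add] at h'
    rw [← Complex.add_re, tendsto_nhds_unique h' (h.congr fun n => ((τ n).add _ _).symm)]

theorem tendsto_reLimitTrace (τ : ℕ → TracialState A) (x : EllInfty A) :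
    Tendsto (fun n => (τ n (x n)).re) U (𝓝 (reLimitTrace U τ (tracialClass U x))) :=
  (Complex.continuous_re.tendsto _).comp (tendsto_limitTrace U τ x)

theorem reLimitTrace_one (τ : ℕ → TracialState A) : reLimitTrace U τ 1 = 1 := by
  have h := tendsto_reLimitTrace U τ 1
  rw [map_one] at h
  refine tendsto_nhds_unique h (tendsto_const_nhds.congr fun n => ?_)
  rw [BoundedContinuousFunction.coe_one, Pi.one_apply, (τ n).one, Complex.one_re]

theorem isRealTrace_reLimitTrace (τ : ℕ → TracialState A) : IsRealTrace (reLimitTrace U τ) where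
  nonneg x := by
    obtain ⟨x, rfl⟩ := tracialClass_surjective U x
    rw [← map_star, ← map_mul]
    exact ge_of_tendsto' (tendsto_reLimitTrace U τ (star x * x)) fun n => (τ n).nonneg (x n)
  comm x y := by
    obtain ⟨x, rfl⟩ := tracialClass_surjective U x
    obtain ⟨y, rfl⟩ := tracialClass_surjective U y
    rw [← map_mul, ← map_mul]
    refine tendsto_nhds_unique (tendsto_reLimitTrace U τ (x * y))
      ((tendsto_reLimitTrace U τ (y * x)).congr fun n => ?_)
    exact congrArg Complex.re ((τ n).comm _ _)

theorem reLimitTrace_map {τ : ℕ → TracialState A} {φ : A ≃⋆ₐ[ℂ] A}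
    (hτ : ∀ n a, τ n (φ a) = τ n a) (x : TracialUltrapower U A) :
    reLimitTrace U τ (tracialUltraMap U φ x) = reLimitTrace U τ x := by
  obtain ⟨x, rfl⟩ := tracialClass_surjective U x
  rw [tracialUltraMap_tracialClass]
  refine tendsto_nhds_unique (tendsto_reLimitTrace U τ _)
    ((tendsto_reLimitTrace U τ x).congr fun n => ?_)
  rw [ellInftyMap_apply, hτ]

/-- A bound for all limit traces coming from `T` is a uniform bound over `T` along `U`: otherwise
nearly maximising traces would assemble to a limit trace violating it. -/
theorem eventually_norm2Sup_lt {T : Set (TracialState A)} (hT : T.Nonempty) {x : EllInfty A}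
    {c ε : ℝ} (hε : 0 < ε) (hc : c < ε ^ 2)
    (h : ∀ τ : ℕ → TracialState A, (∀ n, τ n ∈ T) →
      reLimitTrace U τ (star (tracialClass U x) * tracialClass U x) ≤ c) :
    ∀ᶠ n in U, norm2Sup T (x n) < ε := by
  by_contra hcon
  rw [← Ultrafilter.eventually_not] at hcon
  obtain ⟨τ₀, hτ₀⟩ := hT
  have : Nonempty T := ⟨⟨τ₀, hτ₀⟩⟩
  have hc0 : 0 ≤ c := ((isRealTrace_reLimitTrace U fun _ => τ₀).nonneg _).trans
    (h (fun _ => τ₀) fun _ => hτ₀)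
  obtain ⟨c', hc', hc'ε⟩ := exists_between hc
  have hsq : √c' < ε := by
    rw [Real.sqrt_lt' hε]
    exact hc'ε
  have hex : ∀ n, ∃ τ ∈ T, ¬ norm2Sup T (x n) < ε → c' ≤ (τ (star (x n) * x n)).re := by
    intro n
    by_cases hn : norm2Sup T (x n) < ε
    · exact ⟨τ₀, hτ₀, fun h => absurd hn h⟩
    · obtain ⟨τ, hτ⟩ := exists_lt_of_lt_ciSup (hsq.trans_le (not_lt.1 hn))
      refine ⟨τ.1, τ.2, fun _ => ?_⟩
      rw [← TracialState.norm2_sq, ← Real.sq_sqrt (hc0.trans hc'.le)]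
      exact pow_le_pow_left₀ (Real.sqrt_nonneg _) hτ.le 2
  choose τ hτT hτ using hex
  have h1 := h τ hτT
  rw [← map_star, ← map_mul] at h1
  have h2 : c' ≤ reLimitTrace U τ (tracialClass U (star x * x)) :=
    ge_of_tendsto (tendsto_reLimitTrace U τ (star x * x)) (hcon.mono fun n hn => hτ n hn)
  linarith

end LimitTrace

/-! ### Invariant traces -/

section InvariantTraces

variable {A : Type*} [CStarAlgebra A] {G : Type*} [Group G]

/-- Averaging the translates of a trace by an invariant mean yields an invariant trace. -/
theorem invariantTraces_nonempty (hG : IsAmenableGroup G) (α : G →* (A ≃⋆ₐ[ℂ] A))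
    (τ : TracialState A) : (invariantTraces α).Nonempty := by
  obtain ⟨m, hm1, hm⟩ := hG
  let R : A → G → ℝ := fun a g => (τ (α g⁻¹ a)).re
  let J : A → G → ℝ := fun a g => (τ (α g⁻¹ a)).im
  have hbd : ∀ a g, ‖τ (α g⁻¹ a)‖ ≤ ‖a‖ := fun a g =>
    (τ.norm_apply_le_norm2 _).trans ((τ.norm2_le_norm _).trans (StarAlgEquiv.norm_map _ _).le)
  have hR : ∀ a, ∃ C, ∀ g, |R a g| ≤ C := fun a =>
    ⟨‖a‖, fun g => (Complex.abs_re_le_norm _).trans (hbd a g)⟩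
  have hJ : ∀ a, ∃ C, ∀ g, |J a g| ≤ C := fun a =>
    ⟨‖a‖, fun g => (Complex.abs_im_le_norm _).trans (hbd a g)⟩
  have hsm : ∀ (c : ℝ) {f : G → ℝ}, (∃ C, ∀ g, |f g| ≤ C) → ∃ C, ∀ g, |(c • f) g| ≤ C := by
    rintro c f ⟨C, hC⟩
    refine ⟨|c| * C, fun g => ?_⟩
    rw [Pi.smul_apply, smul_eq_mul, abs_mul]
    exact mul_le_mul_of_nonneg_left (hC g) (abs_nonneg c)
  have hadd : ∀ {f f' : G → ℝ}, (∃ C, ∀ g, |f g| ≤ C) → (∃ C, ∀ g, |f' g| ≤ C) →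
      m (f + f') = m f + m f' := fun hf hf' => (hm _ hf).2.2.1 _ hf'
  have hmul : ∀ (c : ℝ) {f : G → ℝ}, (∃ C, ∀ g, |f g| ≤ C) → m (c • f) = c * m f :=
    fun c f hf => (hm _ hf).2.1 c
  have hzero : m 0 = 0 := by
    have := hmul 0 (hR 0)
    rwa [zero_smul, zero_mul] at this
  let σ : A → ℂ := fun a => ⟨m (R a), m (J a)⟩
  have hRadd : ∀ a b, R (a + b) = R a + R b := fun a b => by
    funext g
    simp only [R, map_add, τ.add, Complex.add_re, Pi.add_apply]
  have hJadd : ∀ a b, J (a + b) = J a + J b := fun a b => by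
    funext g
    simp only [J, map_add, τ.add, Complex.add_im, Pi.add_apply]
  have hRsm : ∀ (c : ℂ) a, R (c • a) = c.re • R a + (-c.im) • J a := fun c a => by
    funext g
    simp only [R, J, map_smul, τ.smul, Complex.mul_re, Pi.add_apply, Pi.smul_apply, smul_eq_mul]
    ring
  have hJsm : ∀ (c : ℂ) a, J (c • a) = c.re • J a + c.im • R a := fun c a => by
    funext g
    simp only [R, J, map_smul, τ.smul, Complex.mul_im, Pi.add_apply, Pi.smul_apply, smul_eq_mul]
  let τ' : TracialState A :=
    { toFun := σ
      map_add' := fun a b => by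
        apply Complex.ext
        · exact (congrArg m (hRadd a b)).trans (hadd (hR a) (hR b))
        · exact (congrArg m (hJadd a b)).trans (hadd (hJ a) (hJ b))
      map_smul' := fun c a => by
        apply Complex.ext
        · refine (congrArg m (hRsm c a)).trans ?_
          rw [hadd (hsm _ (hR a)) (hsm _ (hJ a)), hmul _ (hR a), hmul _ (hJ a)]
          simp only [σ, RingHom.id_apply, smul_eq_mul, Complex.mul_re]
          ring
        · refine (congrArg m (hJsm c a)).trans ?_
          rw [hadd (hsm _ (hJ a)) (hsm _ (hR a)), hmul _ (hR a), hmul _ (hJ a)]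
          simp only [σ, RingHom.id_apply, smul_eq_mul, Complex.mul_im]
      map_one' := by
        apply Complex.ext
        · refine (congrArg m (?_ : R 1 = 1)).trans hm1
          funext g
          simp only [R, map_one, τ.one, Complex.one_re, Pi.one_apply]
        · refine (congrArg m (?_ : J 1 = 0)).trans hzero
          funext g
          simp only [J, map_one, τ.one, Complex.one_im, Pi.zero_apply]
      map_star_mul_self_nonneg' := fun a => by
        refine Complex.nonneg_iff.2 ⟨(hm _ (hR _)).1 fun g => ?_, ?_⟩
        · simp only [R, map_mul, map_star]
          exact τ.nonneg _
        · refine ((congrArg m (?_ : J (star a * a) = 0)).trans hzero).symm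
          funext g
          simp only [J, map_mul, map_star]
          exact τ.self_im _
      map_mul_comm' := fun a b => by
        have h : ∀ g, τ (α g⁻¹ (a * b)) = τ (α g⁻¹ (b * a)) := fun g => by
          rw [map_mul, map_mul, τ.comm]
        apply Complex.ext
        · exact congrArg m (funext fun g => congrArg Complex.re (h g))
        · exact congrArg m (funext fun g => congrArg Complex.im (h g)) }
  refine ⟨τ', fun h a => ?_⟩
  have ht : ∀ g, τ (α g⁻¹ (α h a)) = τ (α (h⁻¹ * g)⁻¹ a) := fun g => by
    rw [mul_inv_rev, inv_inv, map_mul]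
    rfl
  apply Complex.ext
  · exact (congrArg m (funext fun g => congrArg Complex.re (ht g))).trans
      ((hm _ (hR a)).2.2.2 h⁻¹)
  · exact (congrArg m (funext fun g => congrArg Complex.im (ht g))).trans
      ((hm _ (hJ a)).2.2.2 h⁻¹)

end InvariantTraces

/-! ### Constant sequences and relative commutants -/

section Unitaries

variable {A : Type*} [CStarAlgebra A]

/-- The embedding of `A` into `ℓ^∞(A)` as constant sequences. -/
def constHom (A : Type*) [CStarAlgebra A] : A →⋆ₐ[ℂ] EllInfty A where
  toFun a := BoundedContinuousFunction.const ℕ a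
  map_one' := rfl
  map_mul' _ _ := rfl
  map_zero' := rfl
  map_add' _ _ := rfl
  commutes' _ := rfl
  map_star' _ := rfl

theorem exists_denseRange_unitary (A : Type*) [CStarAlgebra A]
    [TopologicalSpace.SeparableSpace A] : ∃ v : ℕ → unitary A, DenseRange v := by
  have : SecondCountableTopology A := UniformSpace.secondCountable_of_separable A
  exact ⟨_, TopologicalSpace.denseRange_denseSeq (unitary A)⟩

/-- Commuting modulo a closed ideal with a dense set of unitaries suffices for commuting with
the whole algebra. -/
theorem commutator_mem_of_denseRange {I : Ideal (EllInfty A)} [I.IsTwoSided]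
    (hI : IsClosed (I : Set (EllInfty A))) {v : ℕ → unitary A} (hv : DenseRange v)
    {x : EllInfty A} (hx : ∀ j, constHom A (v j) * x - x * constHom A (v j) ∈ I) (a : A) :
    constHom A a * x - x * constHom A a ∈ I := by
  let L : A →ₗ[ℂ] EllInfty A :=
    LinearMap.mulRight ℂ x ∘ₗ (constHom A : A →ₐ[ℂ] EllInfty A).toLinearMap -
      LinearMap.mulLeft ℂ x ∘ₗ (constHom A : A →ₐ[ℂ] EllInfty A).toLinearMap
  have hL : ∀ a, L a = constHom A a * x - x * constHom A a := fun a => rfl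
  have hLc : Continuous L := by
    have hc : Continuous (constHom A) := AddMonoidHomClass.continuous_of_bound _ 1 fun a => by
      rw [one_mul]
      exact BoundedContinuousFunction.norm_const_le a
    exact (hc.mul continuous_const).sub (continuous_const.mul hc)
  have hu : ∀ u : unitary A, L u ∈ I := fun u => by
    have hcl : IsClosed {u : unitary A | L u ∈ I} :=
      hI.preimage (hLc.comp continuous_subtype_val)
    exact hv.induction_on u hcl hx
  have htop : (⊤ : Submodule ℂ A) ≤ (I.restrictScalars ℂ).comap L := by
    rw [← CStarAlgebra.span_unitary, Submodule.span_le]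
    exact fun u hu' => hu ⟨u, hu'⟩
  exact htop (Submodule.mem_top (x := a))

variable (U : Ultrafilter ℕ)

theorem mem_tracialCentral_iff {x : TracialUltrapower U A} :
    x ∈ tracialCentral U A ↔
      ∀ a : A, tracialClass U (constHom A a) * x = x * tracialClass U (constHom A a) := by
  unfold tracialCentral
  rw [StarSubalgebra.mem_centralizer_iff]
  constructor
  · exact fun h a => (h _ ⟨a, rfl⟩).1
  · rintro h _ ⟨a, rfl⟩
    refine ⟨h a, ?_⟩
    have := h (star a)
    rwa [map_star, map_star] at this

theorem mem_normCentral_iff {x : NormUltrapower U A} :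
    x ∈ normCentral U A ↔
      ∀ a : A, normClass U (constHom A a) * x = x * normClass U (constHom A a) := by
  unfold normCentral
  rw [StarSubalgebra.mem_centralizer_iff]
  constructor
  · exact fun h a => (h _ ⟨a, rfl⟩).1
  · rintro h _ ⟨a, rfl⟩
    refine ⟨h a, ?_⟩
    have := h (star a)
    rwa [map_star, map_star] at this

theorem tracialUltraMap_mem_tracialCentral (φ : A ≃⋆ₐ[ℂ] A) {x : TracialUltrapower U A}
    (hx : x ∈ tracialCentral U A) : tracialUltraMap U φ x ∈ tracialCentral U A := by
  rw [mem_tracialCentral_iff] at hx ⊢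
  intro a
  have e : tracialClass U (constHom A a)
      = tracialUltraMap U φ (tracialClass U (constHom A (φ.symm a))) := by
    rw [tracialUltraMap_tracialClass]
    congr 1
    ext n
    exact (φ.apply_symm_apply a).symm
  rw [e, ← map_mul, hx, map_mul]

theorem tracialUltraMap_mul {G : Type*} [Group G] (α : G →* (A ≃⋆ₐ[ℂ] A)) (g h : G)
    (x : TracialUltrapower U A) :
    tracialUltraMap U (α (g * h)) x = tracialUltraMap U (α g) (tracialUltraMap U (α h) x) := by
  obtain ⟨x, rfl⟩ := tracialClass_surjective U x
  simp only [tracialUltraMap_tracialClass]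
  congr 1
  ext n
  simp only [ellInftyMap_apply, map_mul]
  rfl

theorem tracialUltraMap_one {G : Type*} [Group G] (α : G →* (A ≃⋆ₐ[ℂ] A))
    (x : TracialUltrapower U A) : tracialUltraMap U (α 1) x = x := by
  obtain ⟨x, rfl⟩ := tracialClass_surjective U x
  rw [tracialUltraMap_tracialClass]
  congr 1
  ext n
  simp only [ellInftyMap_apply, map_one]
  rfl

end Unitaries

/-! ### Reindexing central matrix units -/

section Reindexing

variable {A : Type*} [CStarAlgebra A] {U : Ultrafilter ℕ}

theorem matrixDefect_apply {d : ℕ} (x : Fin d → Fin d → EllInfty A) (r : MatrixRel d) (n : ℕ) :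
    matrixDefect x r n = matrixDefect (fun k l => x k l n) r := by
  rcases r with ⟨k, l, m, p⟩ | ⟨k, l⟩ | _
  · simp only [matrixDefect]
    split_ifs <;> simp
  · simp [matrixDefect]
  · simp only [matrixDefect]
    rw [BoundedContinuousFunction.sub_apply, BoundedContinuousFunction.coe_sum]
    simp

theorem exists_central_matrixUnits (hA : UniformlyMcDuff U A) {d : ℕ} (hd : 1 ≤ d) :
    ∃ e : Fin d → Fin d → TracialUltrapower U A, (∀ r, matrixDefect e r = 0) ∧
      ∀ k l, e k l ∈ tracialCentral U A := by
  obtain ⟨φ, -⟩ := hA d hd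
  have h0 : ∀ r, matrixDefect (fun k l : Fin d => Matrix.single k l (1 : ℂ)) r = 0 := by
    rintro (⟨k, l, m, n⟩ | ⟨k, l⟩ | _)
    · simp only [matrixDefect]
      split_ifs with h
      · subst h
        simp
      · rw [Matrix.single_mul_single_of_ne (h := h), sub_zero]
    · simp [matrixDefect, Matrix.star_eq_conjTranspose]
    · exact sub_eq_zero.2 Matrix.sum_single_one
  refine ⟨fun k l => φ (Matrix.single k l 1), fun r => ?_, fun k l => (φ _).2⟩
  have := map_matrixDefect ((tracialCentral U A).subtype.comp φ)
    (fun k l : Fin d => Matrix.single k l (1 : ℂ)) r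
  rw [h0, map_zero] at this
  exact this.symm

/-- Central matrix units may be chosen to commute with any given countable subset of `A^U`: entries
far along a sequence of central matrix units almost commute with any prescribed finitely many
elements of `A`, in particular with the `n`-th entries of the given sequences. -/
theorem exists_commuting_matrixUnits [TopologicalSpace.SeparableSpace A]
    (hU : (U : Filter ℕ) ≤ Filter.cofinite) (hA : UniformlyMcDuff U A) {d : ℕ} (hd : 1 ≤ d)
    {J : Type*} [Countable J] (y : J → TracialUltrapower U A) :
    ∃ e : Fin d → Fin d → TracialUltrapower U A, (∀ r, matrixDefect e r = 0) ∧
      (∀ k l, e k l ∈ tracialCentral U A) ∧ ∀ j k l, y j * e k l = e k l * y j := by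
  obtain ⟨e₀, he₀, hc₀⟩ := exists_central_matrixUnits hA hd
  obtain ⟨v, hv⟩ := exists_denseRange_unitary A
  choose x₀ hx₀ using fun k l => tracialClass_surjective U (e₀ k l)
  choose y₀ hy₀ using fun j => tracialClass_surjective U (y j)
  let z : ℕ ⊕ J → EllInfty A := Sum.elim (fun j => constHom A (v j)) y₀
  set T : Set (TracialState A) := Set.univ
  let f : ℕ → MatrixRel d ⊕ (Fin d × Fin d) × (ℕ ⊕ J) → (Fin d × Fin d → A) → ℝ := fun n c x =>
    c.elim (fun r => norm2Sup T (matrixDefect (fun k l => x (k, l)) r))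
      fun q => norm2Sup T (z q.2 n * x q.1 - x q.1 * z q.2 n)
  obtain ⟨x, -, hx⟩ := exists_diagonal U (C := ∑ k, ∑ l, ‖x₀ k l‖) (by positivity) f
    (by rintro n (r | q) x <;> exact norm2Sup_nonneg _ _) (by
    intro n s ε hε
    refine ⟨fun q => x₀ q.1 q.2, fun q => ?_, ?_⟩
    · exact (Finset.single_le_sum (f := fun l => ‖x₀ q.1 l‖) (fun _ _ => norm_nonneg _)
        (Finset.mem_univ q.2)).trans (Finset.single_le_sum (f := fun k => ∑ l, ‖x₀ k l‖)
        (fun _ _ => by positivity) (Finset.mem_univ q.1))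
    · rintro (r | ⟨⟨k, l⟩, j⟩) -
      · have h : matrixDefect x₀ r ∈ traceNull U T := by
          rw [RingHom.mem_ker, map_matrixDefect]
          convert he₀ r using 2
          funext k l
          exact hx₀ k l
        rw [mem_traceNull] at h
        refine (h.eventually_lt_const hε).mono fun m hm => ?_
        rwa [matrixDefect_apply] at hm
      · have h : constHom A (z j n) * x₀ k l - x₀ k l * constHom A (z j n) ∈ traceNull U T := by
          have := (mem_tracialCentral_iff U).1 (hc₀ k l) (z j n)
          rw [← hx₀, ← map_mul, ← map_mul, ← sub_eq_zero, ← map_sub] at this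
          exact this
        rw [mem_traceNull] at h
        exact h.eventually_lt_const hε)
  rw [Nat.cofinite_eq_atTop] at hU
  have hcomm : ∀ j k l, z j * x (k, l) - x (k, l) * z j ∈ traceNull U T := fun j k l =>
    (mem_traceNull U T).2 ((hx (.inr ((k, l), j))).mono_left hU)
  refine ⟨fun k l => tracialClass U (x (k, l)), fun r => ?_, fun k l => ?_, fun j k l => ?_⟩
  · rw [← map_matrixDefect (tracialClass U) (fun k l => x (k, l))]
    refine (mem_traceNull U T).2 (((hx (.inl r)).mono_left hU).congr fun n => ?_)
    rw [matrixDefect_apply]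
    rfl
  · rw [mem_tracialCentral_iff]
    intro a
    have := commutator_mem_of_denseRange (isClosed_traceNull U T) hv (fun j => hcomm (.inl j) k l) a
    rwa [RingHom.mem_ker, map_sub, map_mul, map_mul, sub_eq_zero] at this
  · have := hcomm (.inr j) k l
    rw [RingHom.mem_ker, map_sub, map_mul, map_mul, sub_eq_zero] at this
    rw [← hy₀ j]
    exact this

end Reindexing

/-! ### Invariant matrix units -/

section Assembly

variable {A : Type*} [CStarAlgebra A] [TopologicalSpace.SeparableSpace A] {U : Ultrafilter ℕ}
  {G : Type*} [Group G] [Countable G] {α : G →* (A ≃⋆ₐ[ℂ] A)}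

open Classical in
/-- Contractive almost matrix units in `A^U ∩ A'` that are almost invariant in the trace norms of
invariant traces: the translates of exact matrix units, glued along Rokhlin towers. -/
theorem exists_almost_invariant_matrixUnits (hU : (U : Filter ℕ) ≤ Filter.cofinite)
    (hα : WeakRokhlinInvariantTraces U α) (hA : UniformlyMcDuff U A) {d : ℕ} (hd : 1 ≤ d)
    (K : Finset G) {ε : ℝ} (hε : 0 < ε) :
    ∃ E : Fin d → Fin d → TracialUltrapower U A, (∀ k l, E k l ∈ tracialCentral U A) ∧
      (∀ k l, 1 - star (E k l) * E k l ∈ posCone (TracialUltrapower U A)) ∧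
      ∀ τ : ℕ → TracialState A, (∀ n, τ n ∈ invariantTraces α) →
        (∀ r, reLimitTrace U τ (star (matrixDefect E r) * matrixDefect E r) ≤ ε) ∧
        ∀ g ∈ K, ∀ k l, reLimitTrace U τ (star (tracialUltraMap U (α g) (E k l) - E k l) *
          (tracialUltraMap U (α g) (E k l) - E k l)) ≤ 4 * ε := by
  obtain ⟨m, S, a, hS, hpos, horth, hequi, htr⟩ := hα K ε hε
  -- The towers are extended by zero outside the shapes. The unit `α_g(e)` is used over the level
  -- `g`, hence `e` has to commute with the `g⁻¹`-translate of that level.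
  let b : (Σ _ : Fin m, G) → TracialUltrapower U A := fun i => if i.2 ∈ S i.1 then a i.1 i.2 else 0
  have hb : ∀ i, ∀ g ∈ S i, b ⟨i, g⟩ = a i g := fun i g hg => if_pos hg
  have hb0 : ∀ i, i.2 ∉ S i.1 → b i = 0 := fun i hi => if_neg hi
  obtain ⟨e, he, hec, hey⟩ := exists_commuting_matrixUnits hU hA hd
    fun i : Σ _ : Fin m, G => tracialUltraMap U (α i.2⁻¹) (b i)
  have hfam : IsOrthogonalFamily b fun i k l => tracialUltraMap U (α i.2) (e k l) := by
    refine ⟨fun i => ?_, fun i => ?_, fun i j hij => ?_, fun i r => ?_, fun i k l => ?_⟩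
    · by_cases hi : i.2 ∈ S i.1
      · rw [hb i.1 i.2 hi]
        obtain ⟨w, hw⟩ := (hpos i.1 i.2 hi).2.1
        rw [hw]
        exact star_mul_self_mem_posCone w
      · rw [hb0 i hi]
        exact zero_mem _
    · by_cases hi : i.2 ∈ S i.1
      · rw [hb i.1 i.2 hi]
        obtain ⟨w, hw⟩ := (hpos i.1 i.2 hi).2.2
        rw [hw]
        exact star_mul_self_mem_posCone w
      · rw [hb0 i hi, sub_zero]
        simpa using star_mul_self_mem_posCone (1 : TracialUltrapower U A)
    · by_cases hi : i.2 ∈ S i.1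
      · by_cases hj : j.2 ∈ S j.1
        · rw [hb i.1 i.2 hi, hb j.1 j.2 hj]
          refine horth _ _ hi _ _ hj fun h => hij ?_
          rw [Prod.mk.injEq] at h
          exact Sigma.ext h.1 (heq_of_eq h.2)
        · rw [hb0 j hj, mul_zero]
      · rw [hb0 i hi, zero_mul]
    · rw [← map_matrixDefect, he, map_zero]
    · have := congrArg (tracialUltraMap U (α i.2)) (hey i k l)
      rwa [map_mul, map_mul, ← tracialUltraMap_mul, mul_inv_cancel, tracialUltraMap_one] at this
  have hsum : ∑ i ∈ Finset.univ.sigma S, b i = ∑ i, ∑ g ∈ S i, a i g := by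
    rw [Finset.sum_sigma]
    exact Finset.sum_congr rfl fun i _ => Finset.sum_congr rfl fun g hg => hb i g hg
  refine ⟨fun k l => ∑ i ∈ Finset.univ.sigma S, b i * tracialUltraMap U (α i.2) (e k l),
    fun k l => ?_, fun k l => hfam.one_sub_glue_mem _ k l, fun τ hτ => ⟨fun r => ?_, ?_⟩⟩
  · refine sum_mem fun i hi => mul_mem ?_ (tracialUltraMap_mem_tracialCentral U _ (hec k l))
    rw [Finset.mem_sigma] at hi
    rw [hb i.1 i.2 hi.2]
    exact (hpos i.1 i.2 hi.2).1
  · refine (hfam.trace_matrixDefect_le (isRealTrace_reLimitTrace U τ) _ r).trans ?_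
    rw [hsum]
    exact (htr τ hτ).le
  · intro g hg k l
    refine trace_glue_sub_le (tracialUltraMap_mul U α) hS hfam (fun i g h hh hgh => ?_)
      (isRealTrace_reLimitTrace U τ) (reLimitTrace_one U τ)
      (fun g x => reLimitTrace_map U (fun n a => hτ n g a) x) hε.le hg k l
    rw [hb i h hh, hb i _ hgh, hequi i g h hh hgh]

/-- Matrix units modulo the ideal of the invariant traces that are fixed, modulo this ideal, by
the action and by countably many given inner automorphisms. -/
theorem exists_invariant_matrixUnits (hU : (U : Filter ℕ) ≤ Filter.cofinite)
    (hα : WeakRokhlinInvariantTraces U α) (hA : UniformlyMcDuff U A)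
    (hne : (invariantTraces α).Nonempty) {d : ℕ} (hd : 1 ≤ d) {φ : ℕ ⊕ G → A ≃⋆ₐ[ℂ] A}
    (v : ℕ → unitary A) (hφv : ∀ j, φ (.inl j) = Unitary.conjStarAlgAut ℂ A (v j))
    (hφα : ∀ g, φ (.inr g) = α g) :
    ∃ x : Fin d × Fin d → EllInfty A, (∀ p, ‖x p‖ ≤ 2) ∧
      (∀ r, matrixDefect (fun k l => x (k, l)) r ∈ traceNull U (invariantTraces α)) ∧
      ∀ c p, ellInftyAut (φ c) (x p) - x p ∈ traceNull U (invariantTraces α) := by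
  classical
  let f : ℕ → MatrixRel d ⊕ (Fin d × Fin d) × (ℕ ⊕ G) → (Fin d × Fin d → A) → ℝ := fun _ c x =>
    c.elim (fun r => norm2Sup (invariantTraces α) (matrixDefect (fun k l => x (k, l)) r))
      fun q => norm2Sup (invariantTraces α) (φ q.2 (x q.1) - x q.1)
  obtain ⟨x, hx2, hx⟩ := exists_diagonal U zero_le_two f
    (by rintro n (r | q) x <;> exact norm2Sup_nonneg _ _) (by
    intro n s ε hε
    obtain ⟨E, hEc, hE1, hE⟩ := exists_almost_invariant_matrixUnits hU hα hA hd
      (s.toRight.image (·.2)).toRight (show 0 < ε ^ 2 / 8 by positivity)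
    choose x hx2 hx using fun k l => exists_bounded_lift U Set.univ (hE1 k l)
    have hε2 : 0 < ε ^ 2 := by positivity
    refine ⟨fun p => x p.1 p.2, fun p => hx2 _ _, ?_⟩
    rintro (r | ⟨⟨k, l⟩, j | g⟩) hs
    · have hcl : tracialClass U (matrixDefect x r) = matrixDefect E r := by
        rw [map_matrixDefect]
        congr 1
        funext k l
        exact hx k l
      have := eventually_norm2Sup_lt U hne (x := matrixDefect x r) hε
        (show ε ^ 2 / 8 < ε ^ 2 by linarith) fun τ hτ => by
          rw [hcl]
          exact (hE τ hτ).1 r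
      refine this.mono fun m hm => ?_
      rwa [matrixDefect_apply] at hm
    · have h : ellInftyAut (φ (.inl j)) (x k l) - x k l
          ∈ traceNull U (Set.univ : Set (TracialState A)) := by
        have e : ellInftyAut (φ (.inl j)) (x k l)
            = constHom A (v j) * x k l * constHom A (star (v j : A)) := by
          rw [hφv]
          ext n
          rfl
        rw [RingHom.mem_ker, e, map_sub, map_mul, map_mul, hx,
          (mem_tracialCentral_iff U).1 (hEc k l), mul_assoc, ← map_mul, ← map_mul,
          Unitary.mul_star_self_of_mem (v j).2, map_one, map_one, mul_one, sub_self]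
      rw [mem_traceNull] at h
      refine (h.eventually_lt_const hε).mono fun m hm => lt_of_le_of_lt ?_ hm
      exact norm2Sup_le _ (norm2Sup_nonneg _ _) fun τ _ => le_norm2Sup _ (Set.mem_univ τ) _
    · have hcl : tracialClass U (ellInftyAut (α g) (x k l) - x k l)
          = tracialUltraMap U (α g) (E k l) - E k l := by
        rw [map_sub, ← hx]
        rfl
      have hg : g ∈ (s.toRight.image (·.2)).toRight := by
        rw [Finset.mem_toRight, Finset.mem_image]
        exact ⟨_, Finset.mem_toRight.2 hs, rfl⟩
      have := eventually_norm2Sup_lt U hne (x := ellInftyAut (α g) (x k l) - x k l) hε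
        (show 4 * (ε ^ 2 / 8) < ε ^ 2 by linarith) fun τ hτ => by
          rw [hcl]
          exact (hE τ hτ).2 g hg k l
      refine this.mono fun m hm => ?_
      simp only [f, Sum.elim_inr, hφα]
      exact hm)
  rw [Nat.cofinite_eq_atTop] at hU
  refine ⟨x, hx2, fun r => ?_, fun c p => ?_⟩
  · refine (mem_traceNull U _).2 (((hx (.inl r)).mono_left hU).congr fun n => ?_)
    rw [matrixDefect_apply]
    rfl
  · exact (mem_traceNull U _).2 ((hx (.inr (p, c))).mono_left hU)

omit [TopologicalSpace.SeparableSpace A] in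
/-- Matrix units modulo `J_T` that are fixed modulo `J_T` by countably many automorphisms can be
corrected to be fixed in norm: replace `x` by `(1 - h) x (1 - h)` for a quasi-invariant approximate
unit `h` of the ideal of tracially null sequences. -/
theorem exists_norm_invariant_matrixUnits (hU : (U : Filter ℕ) ≤ Filter.cofinite)
    {T : Set (TracialState A)} {Γ : Type*} [Countable Γ] {φ : Γ → A ≃⋆ₐ[ℂ] A}
    (hφ : ∀ c, ∀ τ ∈ T, ∀ a, τ (φ c a) = τ a) {d : ℕ} {x : Fin d × Fin d → EllInfty A}
    (hx2 : ∀ p, ‖x p‖ ≤ 2) (hx : ∀ r, matrixDefect (fun k l => x (k, l)) r ∈ traceNull U T)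
    (hxφ : ∀ c p, ellInftyAut (φ c) (x p) - x p ∈ traceNull U T) :
    ∃ y : Fin d × Fin d → EllInfty A,
      (∀ r, matrixDefect (fun k l => y (k, l)) r ∈ traceNull U T) ∧
      ∀ c p, ellInftyAut (φ c) (y p) - y p ∈ cIdeal U A := by
  classical
  let f : ℕ → MatrixRel d ⊕ (Fin d × Fin d) × Γ → (Fin d × Fin d → A) → ℝ := fun _ c x =>
    c.elim (fun r => norm2Sup T (matrixDefect (fun k l => x (k, l)) r))
      fun q => ‖φ q.2 (x q.1) - x q.1‖
  obtain ⟨y, -, hy⟩ := exists_diagonal U zero_le_two f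
    (by
      rintro n (r | q) x
      · exact norm2Sup_nonneg _ _
      · exact norm_nonneg _) (by
    intro n s ε hε
    obtain ⟨h, hI, -, h1, hj, hφh⟩ := exists_approximate_unit_traceNull U T
      (fun c : s.toRight.image (·.2) => φ c) (fun c => hφ c) s.toRight
      (fun q => ellInftyAut (φ q.2) (x q.1) - x q.1) (fun q _ => hxφ q.2 q.1)
      (show 0 < ε / 6 by positivity)
    have h0 : traceClass U T h = 0 := hI
    have hnorm : ∀ z : EllInfty A, ‖(1 - h) * z‖ ≤ ‖z‖ ∧ ‖z * (1 - h)‖ ≤ ‖z‖ := fun z =>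
      ⟨(norm_mul_le _ _).trans (mul_le_of_le_one_left (norm_nonneg _) h1),
        (norm_mul_le _ _).trans (mul_le_of_le_one_right (norm_nonneg _) h1)⟩
    -- Cutting down by `1 - h` kills the tracially null errors in norm and, as `h` is almost fixed
    -- and tracially null, neither creates new ones nor changes the class modulo `J_T`.
    refine ⟨fun p => (1 - h) * x p * (1 - h),
      fun p => ((hnorm _).2.trans (hnorm _).1).trans (hx2 p), ?_⟩
    rintro (r | ⟨p, c⟩) hs
    · have h2 : matrixDefect (fun k l => (1 - h) * x (k, l) * (1 - h)) r ∈ traceNull U T := by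
        have := hx r
        rw [RingHom.mem_ker, map_matrixDefect] at this ⊢
        simpa only [map_mul, map_sub, map_one, h0, sub_zero, one_mul, mul_one] using this
      rw [mem_traceNull] at h2
      refine (h2.eventually_lt_const hε).mono fun m hm => ?_
      rwa [matrixDefect_apply] at hm
    · refine Eventually.of_forall fun m => ?_
      set β := ellInftyAut (φ c) with hβ
      have hs' : (p, c) ∈ s.toRight := Finset.mem_toRight.2 hs
      have hk1 : ‖(1 - h) * (β (x p) - x p)‖ ≤ ε / 6 := hj (p, c) hs'
      have hk2 : ‖h - β h‖ ≤ ε / 6 := by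
        rw [norm_sub_rev]
        exact hφh ⟨c, Finset.mem_image.2 ⟨_, hs', rfl⟩⟩
      have e : β ((1 - h) * x p * (1 - h)) - (1 - h) * x p * (1 - h)
          = (h - β h) * β (x p * (1 - h)) + (1 - h) * (β (x p) * (h - β h))
            + (1 - h) * (β (x p) - x p) * (1 - h) := by
        simp only [map_mul, map_sub, map_one]
        noncomm_ring
      have hb : ∀ z, ‖β z‖ = ‖z‖ := fun z => StarAlgEquiv.norm_map β z
      have n1 : ‖(h - β h) * β (x p * (1 - h))‖ ≤ ε / 6 * 2 := by
        refine (norm_mul_le _ _).trans (mul_le_mul hk2 ?_ (norm_nonneg _) (by positivity))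
        rw [hb]
        exact (hnorm _).2.trans (hx2 p)
      have n2 : ‖(1 - h) * (β (x p) * (h - β h))‖ ≤ 2 * (ε / 6) := by
        refine (hnorm _).1.trans ((norm_mul_le _ _).trans
          (mul_le_mul ?_ hk2 (norm_nonneg _) zero_le_two))
        rw [hb]
        exact hx2 p
      have n3 := (hnorm ((1 - h) * (β (x p) - x p))).2.trans hk1
      have n4 := norm_add₃_le (a := (h - β h) * β (x p * (1 - h)))
        (b := (1 - h) * (β (x p) * (h - β h))) (c := (1 - h) * (β (x p) - x p) * (1 - h))
      rw [← e] at n4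
      have n5 := (β ((1 - h) * x p * (1 - h)) - (1 - h) * x p * (1 - h)).norm_coe_le_norm m
      refine lt_of_le_of_lt n5 ?_
      linarith)
  rw [Nat.cofinite_eq_atTop] at hU
  refine ⟨y, fun r => ?_, fun c p => ?_⟩
  · refine (mem_traceNull U _).2 (((hy (.inl r)).mono_left hU).congr fun n => ?_)
    rw [matrixDefect_apply]
    rfl
  · exact (mem_cIdeal U).2 ((hy (.inr (p, c))).mono_left hU)

end Assembly

end

theorem theorem5p5 {G : Type*} [Group G] [Countable G] (hG : IsAmenableGroup G)
    {A : Type*} [CStarAlgebra A] [TopologicalSpace.SeparableSpace A]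
    (U : Ultrafilter ℕ) (hU : (U : Filter ℕ) ≤ Filter.cofinite)
    (α : G →* (A ≃⋆ₐ[ℂ] A)) (hα : WeakRokhlinInvariantTraces U α)
    (hT : Nonempty (TracialState A)) (hA : UniformlyMcDuff U A) :
    McDuffInvariantTraces U α := by
  have hne := invariantTraces_nonempty hG α hT.some
  refine ⟨hne, fun d hd => ?_⟩
  obtain ⟨v, hv⟩ := exists_denseRange_unitary A
  -- Being fixed by these inner automorphisms means commuting with `A`, so that centrality and
  -- invariance can be achieved simultaneously.
  let φ : ℕ ⊕ G → A ≃⋆ₐ[ℂ] A := Sum.elim (fun j => Unitary.conjStarAlgAut ℂ A (v j)) α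
  have hφ : ∀ c, ∀ τ ∈ invariantTraces α, ∀ a, τ (φ c a) = τ a := by
    rintro (j | g) τ hτ a
    · change τ ((v j : A) * a * (star (v j : A))) = τ a
      rw [τ.comm, ← mul_assoc, Unitary.star_mul_self_of_mem (v j).2, one_mul]
    · exact hτ g a
  obtain ⟨x, hx2, hx, hxφ⟩ := exists_invariant_matrixUnits hU hα hA hne hd (φ := φ) v
    (fun _ => rfl) (fun _ => rfl)
  obtain ⟨y, hy, hyφ⟩ := exists_norm_invariant_matrixUnits hU hφ hx2 hx hxφ
  have hmem : ∀ k l, normClass U (y (k, l)) ∈ fixedNormCentral U α := by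
    intro k l
    refine StarSubalgebra.mem_inf.2 ⟨?_, ?_⟩
    · rw [mem_normCentral_iff]
      intro a
      rw [← map_mul, ← map_mul, normClass_eq_iff]
      refine commutator_mem_of_denseRange (isClosed_cIdeal U) hv (fun j => ?_) a
      have h := (cIdeal U A).mul_mem_right (constHom A (v j)) (hyφ (.inl j) (k, l))
      have e : ellInftyAut (φ (.inl j)) (y (k, l))
          = constHom A (v j) * y (k, l) * constHom A (star (v j : A)) := by
        ext n
        rfl
      rwa [e, sub_mul, mul_assoc, ← map_mul, Unitary.star_mul_self_of_mem (v j).2, map_one,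
        mul_one] at h
    · rw [StarSubalgebra.mem_iInf]
      intro g
      exact (normClass_eq_iff U).2 (hyφ (.inr g) (k, l))
  refine exists_starAlgHom_of_matrixUnits (e := fun k l =>
    quotientMk (restrictIdeal (fixedNormCentral U α) (traceIdeal U (invariantTraces α)))
      ⟨normClass U (y (k, l)), hmem k l⟩) fun r => ?_
  rw [← map_matrixDefect]
  refine Ideal.Quotient.eq_zero_iff_mem.2 ?_
  rw [restrictIdeal, Ideal.mem_comap, map_matrixDefect]
  have h := (mem_traceNull U _).1 (hy r)
  rw [← normClass_mem_traceIdeal, map_matrixDefect] at h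
  exact h
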